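/- Let $N\ge 1$ and $S\in\{\tfrac12,1,\tfrac32,\dots\}$. Consider $N$ spins of magnitude $S$, with spin operators $\mathbf S_\alpha=(S_\alpha^x,S_\alpha^y,S_\alpha^z)$ acting on $(\mathbb C^{2S+1})^{\otimes N}$, at the sites $\eta_\alpha=e^{2\pi i\alpha/N}$, $\alpha=1,\dots,N$. Let $\mathbf S_{\rm tot}=\sum_\alpha\mathbf S_\alpha$, $$H^S=\frac{2\pi^2}{N^2}\Big[\sum_{\alpha\ne\beta}\frac{\mathbf S_\alpha\cdot\mathbf S_\beta}{|\eta_\alpha-\eta_\beta|^2}-\frac{1}{2(S+1)(2S+3)}\sum_{\alpha,\ \beta\neq\alpha,\ \gamma\ne\alpha}\frac{(\mathbf S_\alpha\cdot\mathbf S_\beta)(\mathbf S_\alpha\cdot\mathbf S_\gamma)+(\mathbf S_\alpha\cdot\mathbf S_\gamma)(\mathbf S_\alpha\cdot\mathbf S_\beta)}{(\bar\eta_\alpha-\bar\eta_\beta)(\eta_\alpha-\eta_\gamma)}\Big]$$ (the terms with $\beta=\gamma$ are included), $$E_0^S=-\frac{2\pi^2}{N^2}\,\frac{S(S+1)^2}{2S+3}\,\frac{N(N^2+5)}{12},$$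 and $$\mathbf K_{\alpha\beta}=i(\mathbf S_\alpha\times\mathbf S_\beta)+(S+1)\mathbf S_\beta-\frac{1}{S+1}\mathbf S_\alpha(\mathbf S_\alpha\cdot\mathbf S_\beta),\qquad \mathbf D_\alpha=\frac12\sum_{\beta\ne\alpha}\frac{\eta_\alpha+\eta_\beta}{\eta_\alpha-\eta_\beta}\,\mathbf K_{\alpha\beta},\qquad \mathbf B_\alpha=\frac i2\sum_{\beta\neq\alpha}\mathbf K_{\alpha\beta}.$$ For a vector operator $\mathbf A=(A^x,A^y,A^z)$ write $\mathbf A^\dagger\mathbf A=\sum_i (A^i)^\dagger A^i$. Then $$\frac{2\pi^2}{N^2}\Big[\frac{1}{(2S+1)(2S+3)}\sum_\alpha\big(\mathbf D_\alpha^\dagger\mathbf D_\alpha+\mathbf B_\alpha^\dagger\mathbf B_\alpha\big)+\frac{S+1}{2(2S+3)}\mathbf S_{\rm tot}^2\Big]=H^S-E_0^S .$$ The operators $\mathbf D_\alpha^\dagger\mathbf D_\alpha$, $\mathbf B_\alpha^\dagger\mathbf B_\alpha$ (for all $\alpha$) and $\mathbf S_{\rm tot}^2$ are positive semidefinite, and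 hence $H^S-E_0^S\ge 0$. Suppose moreover that $N$ is even. Let $$\Psi^{\rm HS}[a^\dagger,b^\dagger]=\sum_{T}\ \prod_{\alpha<\beta;\ \alpha,\beta\in T}(\eta_\alpha-\eta_\beta)^2\ \prod_{\alpha\in T}\eta_\alpha\ \prod_{\alpha\in T}a_\alpha^\dagger\prod_{\alpha\notin T}b_\alpha^\dagger ,$$ where $T$ runs over the subsets of $\{1,\dots,N\}$ with $N/2$ elements and $a_\alpha^\dagger,b_\alpha^\dagger$ are the creation operators of the Schwinger bosons of site $\alpha$, so that $|S,m\rangle=\frac{(a^\dagger)^{S+m}(b^\dagger)^{S-m}}{\sqrt{(S+m)!\,(S-m)!}}|0\rangle$ on each site, and let $$|\psi_0^S\rangle=\big(\Psi^{\rm HS}[a^\dagger,b^\dagger]\big)^{2S}|0\rangle .$$ Then all components of $\mathbf D_\alpha$, $\mathbf B_\alpha$ (for all $\alpha$) and $\mathbf S_{\rm tot}$, and hence also $\mathbf D_\alpha^\dagger\mathbf D_\alpha$, $\mathbf B_\alpha^\dagger\mathbf B_\alpha$ and $\mathbf S_{\rm tot}^2$, annihilate $|\psi^S_0\rangle$;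 and $|\psi_0^S\rangle$ is a ground state of $H^S$: it is nonzero, $H^S|\psi_0^S\rangle=E_0^S|\psi_0^S\rangle$, and $E_0^S$ is the lowest eigenvalue of $H^S$. -/

import Mathlib

open scoped Matrix ComplexConjugate ComplexOrder

namespace SpinChain

noncomputable section

/-- The spin quantum number `S = d / 2`; the natural number `d` is `2S`. -/
def spinS (d : ℕ) : ℝ := (d : ℝ) / 2

/-- Labels of the product basis of `N` spins `S = d / 2`: at site `α`, the label `k = n α`
stands for the state `|S, m⟩` with `m = k - S`. -/
abbrev Config (N d : ℕ) : Type := Fin N → Fin (d + 1)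

/-- Operators on the Hilbert space `(ℂ^(2S+1))^{⊗ N}`, as matrices in the orthonormal product
basis.  The adjoint is the conjugate transpose. -/
abbrev Op (N d : ℕ) : Type := Matrix (Config N d) (Config N d) ℂ

/-- State vectors, as coordinates in the orthonormal product basis. -/
abbrev Ket (N d : ℕ) : Type := Config N d → ℂ

/-! ### Spin operators -/

/-- The one-site raising operator `S⁺|S, m⟩ = √((S - m)(S + m + 1)) |S, m + 1⟩`;
with `m = k - S` the radicand is `(2S - k)(k + 1)`. -/
def raising (d : ℕ) : Matrix (Fin (d + 1)) (Fin (d + 1)) ℂ :=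
  Matrix.of fun j k =>
    if (j : ℕ) = (k : ℕ) + 1 then
      ((Real.sqrt (((d : ℝ) - (k : ℝ)) * ((k : ℝ) + 1)) : ℝ) : ℂ) else 0

/-- The one-site lowering operator `S⁻ = (S⁺)†`. -/
def lowering (d : ℕ) : Matrix (Fin (d + 1)) (Fin (d + 1)) ℂ := (raising d)ᴴ

/-- The one-site spin vector `(Sˣ, Sʸ, Sᶻ)`, where `S^± = Sˣ ± i Sʸ` and `Sᶻ|S, m⟩ = m|S, m⟩`. -/
def spinOne (d : ℕ) : Fin 3 → Matrix (Fin (d + 1)) (Fin (d + 1)) ℂ :=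
  ![(1 / 2 : ℂ) • (raising d + lowering d),
    (1 / (2 * Complex.I) : ℂ) • (raising d - lowering d),
    Matrix.diagonal fun k => (((k : ℕ) : ℝ) - spinS d : ℝ)]

/-- The operator that acts as `A` on site `α` and as the identity on all the other sites. -/
def onSite {N d : ℕ} (α : Fin N) (A : Matrix (Fin (d + 1)) (Fin (d + 1)) ℂ) : Op N d :=
  Matrix.of fun n m => if ∀ β, β ≠ α → n β = m β then A (n α) (m α) else 0

/-- The spin vector operator `𝐒_α` of site `α`. -/
def spin {N : ℕ} (d : ℕ) (α : Fin N) : Fin 3 → Op N d := fun i => onSite α (spinOne d i)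

/-- The total spin `𝐒_tot = ∑_α 𝐒_α`. -/
def spinTot (N d : ℕ) : Fin 3 → Op N d := fun i => ∑ α : Fin N, spin d α i

/-- The cross product of two vector operators, in this order of the factors. -/
def opCross {N d : ℕ} (A B : Fin 3 → Op N d) : Fin 3 → Op N d :=
  ![A 1 * B 2 - A 2 * B 1, A 2 * B 0 - A 0 * B 2, A 0 * B 1 - A 1 * B 0]

/-- `𝐀†𝐀 = ∑_i (A^i)† A^i` for a vector operator `𝐀`. -/
def normSqOp {N d : ℕ} (A : Fin 3 → Op N d) : Op N d := ∑ i, (A i)ᴴ * A i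

/-! ### The Hamiltonian and its factors -/

/-- The sites `η_α = exp(2πi α / N)`, `α = 1, …, N`, on the unit circle
(`Fin N` counts from `0`). -/
def site {N : ℕ} (α : Fin N) : ℂ :=
  Complex.exp (2 * Real.pi * Complex.I * ((α : ℕ) + 1) / N)

/-- The Hamiltonian `H^S`; in the second sum `β = γ` is allowed. -/
def hamiltonian (N d : ℕ) : Op N d :=
  (2 * (Real.pi : ℂ) ^ 2 / (N : ℂ) ^ 2) •
    ((∑ α : Fin N, ∑ β : Fin N with β ≠ α,
        (1 / ((‖site α - site β‖ : ℝ) : ℂ) ^ 2) • (spin d α ⬝ᵥ spin d β))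
      - (1 / (2 * ((spinS d : ℂ) + 1) * (2 * (spinS d : ℂ) + 3))) •
        ∑ α : Fin N, ∑ β : Fin N with β ≠ α, ∑ γ : Fin N with γ ≠ α,
          (1 / ((conj (site α) - conj (site β)) * (site α - site γ))) •
            ((spin d α ⬝ᵥ spin d β) * (spin d α ⬝ᵥ spin d γ)
              + (spin d α ⬝ᵥ spin d γ) * (spin d α ⬝ᵥ spin d β)))

/-- The energy `E₀^S = -(2π²/N²) · S(S+1)²/(2S+3) · N(N²+5)/12`. -/
def groundEnergy (N d : ℕ) : ℝ :=
  -(2 * Real.pi ^ 2 / (N : ℝ) ^ 2) *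
    (spinS d * (spinS d + 1) ^ 2 / (2 * spinS d + 3)) * ((N : ℝ) * ((N : ℝ) ^ 2 + 5) / 12)

/-- The vector operator `i(𝐒_α × 𝐒_β) + (S+1) 𝐒_β - (S+1)⁻¹ 𝐒_α (𝐒_α · 𝐒_β)`. -/
def bracket {N : ℕ} (d : ℕ) (α β : Fin N) : Fin 3 → Op N d := fun i =>
  Complex.I • opCross (spin d α) (spin d β) i + ((spinS d : ℂ) + 1) • spin d β i
    - (1 / ((spinS d : ℂ) + 1)) • (spin d α i * (spin d α ⬝ᵥ spin d β))

/-- The vector operator `𝐃_α`. -/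
def opD {N : ℕ} (d : ℕ) (α : Fin N) : Fin 3 → Op N d := fun i =>
  (1 / 2 : ℂ) • ∑ β : Fin N with β ≠ α,
    ((site α + site β) / (site α - site β)) • bracket d α β i

/-- The vector operator `𝐁_α`. -/
def opB {N : ℕ} (d : ℕ) (α : Fin N) : Fin 3 → Op N d := fun i =>
  (Complex.I / 2) • ∑ β : Fin N with β ≠ α, bracket d α β i

/-! ### The state -/

/-- The Haldane-Shastry wave function
`∏_{i<j} (z_i - z_j)² ∏_i z_i` at the set `T` of occupied sites (it is symmetric in the `z_i`). -/
def hsWave {N : ℕ} (T : Finset (Fin N)) : ℂ :=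
  (∏ α ∈ T, ∏ β ∈ T with α < β, (site α - site β) ^ 2) * ∏ α ∈ T, site α

/-- The polynomial `Ψ^HS[a†, b†]` in the (commuting) Schwinger boson creation operators.
The variable `Sum.inl α` is `a†_α` and `Sum.inr α` is `b†_α`; the sum runs over the ways to
occupy `N / 2` of the `N` sites by `a` bosons, the other sites being occupied by `b` bosons. -/
def hsPoly (N : ℕ) : MvPolynomial (Fin N ⊕ Fin N) ℂ :=
  ∑ T ∈ (Finset.univ : Finset (Fin N)).powersetCard (N / 2),
    MvPolynomial.C (hsWave T) *
      ((∏ α ∈ T, MvPolynomial.X (Sum.inl α)) * ∏ α ∈ Tᶜ, MvPolynomial.X (Sum.inr α))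

/-- The exponents of the monomial `∏_α (a†_α)^(S+m_α) (b†_α)^(S-m_α)`, where `m_α = n α - S`. -/
def bosonExponent {N d : ℕ} (n : Config N d) : (Fin N ⊕ Fin N) →₀ ℕ :=
  Finsupp.equivFunOnFinite.symm
    (Sum.elim (fun α => (n α : ℕ)) (fun α => d - (n α : ℕ)))

/-- The spin state `P[a†, b†]|0⟩` for a polynomial `P` in which every site carries `2S` bosons.
Since `|S, m⟩ = (a†)^(S+m) (b†)^(S-m) |0⟩ / √((S+m)! (S-m)!)`, its coordinate at `n` is the
coefficient of the corresponding monomial times `∏_α √((S+m_α)! (S-m_α)!)`. -/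
def bosonState (N d : ℕ) (P : MvPolynomial (Fin N ⊕ Fin N) ℂ) : Ket N d := fun n =>
  P.coeff (bosonExponent n) *
    ∏ α, ((Real.sqrt (((n α : ℕ).factorial : ℝ) * ((d - (n α : ℕ)).factorial : ℝ)) : ℝ) : ℂ)

/-- The state `|ψ₀^S⟩ = (Ψ^HS[a†, b†])^{2S} |0⟩`. -/
def psi0 (N d : ℕ) : Ket N d := bosonState N d (hsPoly N ^ d)

/-- `ψ` is a ground state of `H` with energy `E`: a nonzero eigenvector whose eigenvalue `E`
is the lowest one. -/
def IsGroundState {N d : ℕ} (H : Op N d) (E : ℝ) (ψ : Ket N d) : Prop :=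
  ψ ≠ 0 ∧ H *ᵥ ψ = (E : ℂ) • ψ ∧
    ∀ (E' : ℝ) (φ : Ket N d), φ ≠ 0 → H *ᵥ φ = (E' : ℂ) • φ → E ≤ E'

end

end SpinChain

open SpinChain

namespace SpinChain

/-! Factorization. Adjoining a vector index to spin `S` gives `1 ⊗ S`, and `topMatrix` is `M_α =
(2S+1) × (projection onto total spin S+1)`. It is Hermitian, `M_α² = (2S+1) M_α`, `M_α 𝐒_α = 0`, and
`𝐊_{αβ} = M_α 𝐒_β` (`bracket_eq_mulVec`). Hence `𝐃†𝐃` and `𝐁†𝐁` are `(2S+1)` times forms `𝐒_β · M_α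
𝐒_γ`, linear in `M_α`. With `θ_{αβ} = (η_α + η_β)/(η_α - η_β)`, which is imaginary, their sum
carries the symmetric weight `(1 - θ_{αβ} θ_{αγ})/4`. Symmetrization kills the cross-product part of
`M_α` except at `β = γ`. The last part of `M_α` yields the three-spin term of the Hamiltonian, and
the cotangent addition formula collapses the sum over the central site in the middle part
(`sum_three_site`), leaving two-spin terms, `𝐒_tot²` and the constant. Positivity is then immediate.

Annihilation. Spin operators act on Schwinger-boson polynomials as first-order derivations, so a
derivation that kills `Ψ^HS` kills all its powers: spin `S` reduces to spin `1/2`. The lowering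
operator kills `Ψ^HS` because, as a function of one coordinate, the wave function is a polynomial
without constant term and of degree below `N`. The weight is zero at half filling, and the raising
operator then vanishes by a norm computation. So `Ψ^HS` is a singlet, and `𝐁_α`, being `M_α` applied
to a multiple of `𝐒_tot`, kills the state.

For `𝐃_α`, only the spin `S+1` part at `α` of `∑_β θ_{αβ} 𝐒_β ψ` matters. Contracting the vector
index with two copies of the spinor `(a_α, b_α)` encodes that part as `cotExchange` applied to the
polynomial. On `Ψ^HS` the result is killed by the raising operator, since the exchanges are
invariant, and is divisible by `b_α`, since the double zero of the wave function absorbs the pole of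
`θ`. These two properties force it to vanish (`eq_zero_of_raisingDer_eq_zero`); `topVec_eq_zero`
carries this back to `𝐃_α`. -/

/-! ### Roots of unity and cotangent sums -/

lemma site_eq_pow {N : ℕ} (α : Fin N) :
    site α = Complex.exp (2 * Real.pi * Complex.I / N) ^ ((α : ℕ) + 1) := by
  rw [site, ← Complex.exp_nat_mul]
  congr 1
  push_cast
  ring

lemma site_pow_card {N : ℕ} (α : Fin N) : site α ^ N = 1 := by
  have hN : N ≠ 0 := by have := α.isLt; omega
  rw [site_eq_pow, ← pow_mul, mul_comm ((α : ℕ) + 1), pow_mul, (Complex.isPrimitiveRoot_exp N hN).pow_eq_one,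
    one_pow]

lemma site_ne_zero {N : ℕ} (α : Fin N) : site α ≠ 0 := Complex.exp_ne_zero _

lemma site_injective {N : ℕ} : Function.Injective (site : Fin N → ℂ) := by
  intro α β h
  have hN : N ≠ 0 := by have := α.isLt; omega
  have hζ := Complex.isPrimitiveRoot_exp N hN
  rw [site_eq_pow, site_eq_pow, pow_succ, pow_succ] at h
  exact Fin.ext (hζ.pow_inj α.isLt β.isLt (mul_right_cancel₀ (Complex.exp_ne_zero _) h))

lemma site_sub_ne_zero {N : ℕ} {α β : Fin N} (h : α ≠ β) : site α - site β ≠ 0 :=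
  sub_ne_zero.mpr fun e => h (site_injective e)

lemma conj_site {N : ℕ} (α : Fin N) : conj (site α) = (site α)⁻¹ := by
  rw [site, ← Complex.exp_conj, ← Complex.exp_neg]
  congr 1
  simp [div_eq_mul_inv, map_ofNat]

/-- Power sums over the sites. -/
lemma sum_site_pow {N k : ℕ} (hk : k ≠ 0) (hkN : k < N) : ∑ α : Fin N, site α ^ k = 0 := by
  have hN : N ≠ 0 := by omega
  have hζ := Complex.isPrimitiveRoot_exp N hN
  set ζ := Complex.exp (2 * Real.pi * Complex.I / N) with hζdef
  have h1 : ζ ^ k ≠ 1 := hζ.pow_ne_one_of_pos_of_lt hk hkN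
  have h2 : ∑ α : Fin N, site α ^ k = ζ ^ k * ∑ i ∈ Finset.range N, (ζ ^ k) ^ i := by
    rw [Finset.mul_sum, ← Fin.sum_univ_eq_sum_range (fun i => ζ ^ k * (ζ ^ k) ^ i)]
    refine Finset.sum_congr rfl fun α _ => ?_
    rw [site_eq_pow, ← hζdef, ← pow_mul]
    ring
  have h3 : (∑ i ∈ Finset.range N, (ζ ^ k) ^ i) * (ζ ^ k - 1) = 0 := by
    rw [geom_sum_mul, ← pow_mul, mul_comm, pow_mul, hζ.pow_eq_one, one_pow, sub_self]
  rw [h2, (mul_eq_zero.mp h3).resolve_right (sub_ne_zero.mpr h1), mul_zero]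

/-- Only the exponents `1, …, N - 1` occur, and each of these power sums vanishes. The lowering
identities for the wave function rest on this. -/
lemma sum_eval_site {N : ℕ} (p : Polynomial ℂ) (h0 : p.coeff 0 = 0) (hp : p.natDegree < N) :
    ∑ α : Fin N, p.eval (site α) = 0 := by
  simp_rw [Polynomial.eval_eq_sum_range]
  rw [Finset.sum_comm]
  refine Finset.sum_eq_zero fun k hk => ?_
  rw [← Finset.mul_sum]
  rcases eq_or_ne k 0 with rfl | hk0
  · rw [h0, zero_mul]
  · rw [sum_site_pow hk0 (by have := Finset.mem_range.mp hk; omega), mul_zero]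

/-- `θ_{αβ} = (η_α + η_β) / (η_α - η_β)`, which is `-i cot` of half the angle between the sites. -/
noncomputable def cotCoef {N : ℕ} (α β : Fin N) : ℂ := (site α + site β) / (site α - site β)

/-- A consequence of division by zero being zero; it lets sums over `β ≠ α` run over all sites. -/
lemma cotCoef_self {N : ℕ} (α : Fin N) : cotCoef α α = 0 := by simp [cotCoef]

lemma cotCoef_swap {N : ℕ} (α β : Fin N) : cotCoef β α = -cotCoef α β := by
  rw [cotCoef, cotCoef, ← neg_sub (site α) (site β), div_neg, add_comm]

/-- On the unit circle conjugation is inversion. The sign is why `𝐃†𝐃` contributes `-θθ/4` and `𝐁†𝐁`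
contributes `+1/4`. -/
lemma conj_cotCoef {N : ℕ} (α β : Fin N) : conj (cotCoef α β) = -cotCoef α β := by
  rcases eq_or_ne α β with rfl | h
  · simp [cotCoef_self]
  have h1 := site_ne_zero α
  have h2 := site_ne_zero β
  have h3 := site_sub_ne_zero h
  have h4 := site_sub_ne_zero h.symm
  have h5 : (site α)⁻¹ - (site β)⁻¹ ≠ 0 := by
    rw [inv_sub_inv h1 h2]
    exact div_ne_zero h4 (mul_ne_zero h1 h2)
  rw [cotCoef, map_div₀, map_add, map_sub, conj_site, conj_site, ← neg_div, div_eq_div_iff h5 h3]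
  field_simp
  ring

lemma weight_eq_cotCoef {N : ℕ} {α β γ : Fin N} (hβ : β ≠ α) (hγ : γ ≠ α) :
    1 / ((conj (site α) - conj (site β)) * (site α - site γ))
      = (1 - cotCoef α β) * (1 + cotCoef α γ) / 4 := by
  have h1 := site_ne_zero α
  have h2 := site_ne_zero β
  have h3 := site_sub_ne_zero hβ.symm
  have h3' := site_sub_ne_zero hβ
  have h4 := site_sub_ne_zero hγ.symm
  have h5 : (site α)⁻¹ - (site β)⁻¹ = (site β - site α) / (site α * site β) := inv_sub_inv h1 h2
  rw [conj_site, conj_site, h5, cotCoef, cotCoef]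
  have h6 : site β - site α = -(site α - site β) := by ring
  rw [h6]
  field_simp
  ring

lemma dist_weight_eq_cotCoef {N : ℕ} {α β : Fin N} (h : β ≠ α) :
    1 / ((‖site α - site β‖ : ℝ) : ℂ) ^ 2 = (1 - cotCoef α β * cotCoef α β) / 4 := by
  have h1 := weight_eq_cotCoef h h
  rw [← map_sub, Complex.conj_mul'] at h1
  rw [h1]
  ring

/-- The addition formula of the cotangent. It makes a product of two `θ` with common site `α` linear
in the `θ` that depend on `α`. -/
lemma cotCoef_mul_cotCoef {N : ℕ} {α β γ : Fin N} (h1 : α ≠ β) (h2 : α ≠ γ) (h3 : β ≠ γ) :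
    cotCoef α β * cotCoef α γ = 1 + cotCoef β γ * (cotCoef α β - cotCoef α γ) := by
  have := site_sub_ne_zero h1
  have := site_sub_ne_zero h2
  have := site_sub_ne_zero h3
  rw [cotCoef, cotCoef, cotCoef]
  field_simp
  ring

/-- Multiplied out by the power of `1 - x`, the closed form needs no case distinction and follows by
induction. -/
lemma sum_range_mul_pow (x : ℂ) (n : ℕ) :
    (1 - x) ^ 2 * ∑ k ∈ Finset.range n, (k : ℂ) * x ^ k
      = x - n * x ^ n + (n - 1) * x ^ (n + 1) := by
  induction n with
  | zero => simp
  | succ n ih =>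
    rw [Finset.sum_range_succ, mul_add, ih]
    push_cast
    ring

lemma sum_range_sq_mul_pow (x : ℂ) (n : ℕ) :
    (1 - x) ^ 3 * ∑ k ∈ Finset.range n, (k : ℂ) ^ 2 * x ^ k
      = x + x ^ 2 - n ^ 2 * x ^ n + (2 * n ^ 2 - 2 * n - 1) * x ^ (n + 1)
        - (n - 1) ^ 2 * x ^ (n + 2) := by
  induction n with
  | zero => simp
  | succ n ih =>
    rw [Finset.sum_range_succ, mul_add, ih]
    push_cast
    ring

lemma sum_range_cast (n : ℕ) : ∑ k ∈ Finset.range n, (k : ℂ) = n * (n - 1) / 2 := by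
  induction n with
  | zero => simp
  | succ n ih =>
    rw [Finset.sum_range_succ, ih]
    push_cast
    ring

lemma sum_range_cast_sq (n : ℕ) :
    ∑ k ∈ Finset.range n, (k : ℂ) ^ 2 = n * (n - 1) * (2 * n - 1) / 6 := by
  induction n with
  | zero => simp
  | succ n ih =>
    rw [Finset.sum_range_succ, ih]
    push_cast
    ring

/-- A trigonometric sum whose zero mode vanishes sums to zero over the sites. -/
lemma sum_ratio_modes {N : ℕ} (β : Fin N) (c : ℕ → ℂ) (h0 : c 0 = 0) :
    ∑ α : Fin N, ∑ k ∈ Finset.range N, c k * (site α / site β) ^ k = 0 := by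
  rw [Finset.sum_comm]
  refine Finset.sum_eq_zero fun k hk => ?_
  rcases eq_or_ne k 0 with rfl | hk0
  · simp [h0]
  · simp_rw [div_pow, mul_div_assoc', ← Finset.sum_div, ← Finset.mul_sum,
      sum_site_pow hk0 (Finset.mem_range.mp hk)]
    simp

/-- The full sum is zero, so the rest is minus the term `α = β`, where the ratio is `1`. -/
lemma sum_modes_off_diag {N : ℕ} (β : Fin N) (c : ℕ → ℂ) (h0 : c 0 = 0) :
    ∑ α : Fin N with α ≠ β, ∑ k ∈ Finset.range N, c k * (site α / site β) ^ k
      = -∑ k ∈ Finset.range N, c k := by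
  have h := sum_ratio_modes β c h0
  rw [← Finset.sum_filter_add_sum_filter_not Finset.univ (fun α => α ≠ β)] at h
  simp only [ne_eq, not_not, Finset.filter_eq', Finset.mem_univ, if_true, Finset.sum_singleton,
    div_self (site_ne_zero β), one_pow, mul_one] at h
  exact eq_neg_of_add_eq_zero_left h

/-- A finite Fourier expansion off the diagonal: with `x = η_α / η_β` and `x ^ N = 1`, the sum of `k
x^k` is `-N / (1 - x)`. -/
lemma cotCoef_eq_modes {N : ℕ} {α β : Fin N} (h : α ≠ β) :
    cotCoef α β = 1 + 2 / N * ∑ k ∈ Finset.range N, (k : ℂ) * (site α / site β) ^ k := by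
  have hN : (N : ℂ) ≠ 0 := by
    have := α.isLt
    exact_mod_cast (show N ≠ 0 by omega)
  have hb := site_ne_zero β
  have hab := site_sub_ne_zero h
  have hx : (site α / site β) ^ N = 1 := by rw [div_pow, site_pow_card, site_pow_card, div_one]
  have hx' : site α / site β * site β = site α := div_mul_cancel₀ _ hb
  set x := site α / site β
  have hx1 : 1 - x ≠ 0 := by
    intro e
    apply hab
    rw [← hx']
    linear_combination -site β * e
  have e1 : cotCoef α β = (x + 1) / (x - 1) := by
    rw [cotCoef, ← hx', show x * site β + site β = (x + 1) * site β by ring,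
      show x * site β - site β = (x - 1) * site β by ring, mul_div_mul_right _ _ hb]
  have e2 := sum_range_mul_pow x N
  rw [pow_succ x N, hx] at e2
  have e3 : ∑ k ∈ Finset.range N, (k : ℂ) * x ^ k = -N / (1 - x) := by
    rw [eq_div_iff hx1]
    apply mul_left_cancel₀ hx1
    linear_combination e2
  have hx2 : x - 1 ≠ 0 := fun e => hx1 (by linear_combination -e)
  rw [e1, e3, show 1 - x = -(x - 1) by ring]
  field_simp
  ring

lemma one_sub_cotCoef_sq_eq_modes {N : ℕ} {α β : Fin N} (h : α ≠ β) :
    (1 - cotCoef α β * cotCoef α β) / 4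
      = ∑ k ∈ Finset.range N, (-(k * (N - k) / (2 * N)) : ℂ) * (site α / site β) ^ k := by
  have hN : (N : ℂ) ≠ 0 := by
    have := α.isLt
    exact_mod_cast (show N ≠ 0 by omega)
  have hb := site_ne_zero β
  have hab := site_sub_ne_zero h
  have hx : (site α / site β) ^ N = 1 := by rw [div_pow, site_pow_card, site_pow_card, div_one]
  have hx' : site α / site β * site β = site α := div_mul_cancel₀ _ hb
  set x := site α / site β
  have hx1 : 1 - x ≠ 0 := by
    intro e
    apply hab
    rw [← hx']
    linear_combination -site β * e
  have e1 : cotCoef α β = (x + 1) / (x - 1) := by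
    rw [cotCoef, ← hx', show x * site β + site β = (x + 1) * site β by ring,
      show x * site β - site β = (x - 1) * site β by ring, mul_div_mul_right _ _ hb]
  have e2 := sum_range_mul_pow x N
  have e3 := sum_range_sq_mul_pow x N
  rw [pow_succ x N, hx] at e2
  rw [pow_succ x (N + 1), pow_succ x N, hx] at e3
  have hx2 : x - 1 ≠ 0 := fun e => hx1 (by linear_combination -e)
  have e4 : ∑ k ∈ Finset.range N, (-(k * (N - k) / (2 * N)) : ℂ) * x ^ k
      = (1 / (2 * N)) * ∑ k ∈ Finset.range N, (k : ℂ) ^ 2 * x ^ k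
        - (1 / 2) * ∑ k ∈ Finset.range N, (k : ℂ) * x ^ k := by
    rw [Finset.mul_sum, Finset.mul_sum, ← Finset.sum_sub_distrib]
    refine Finset.sum_congr rfl fun k _ => ?_
    field_simp
    ring
  rw [e4, e1]
  apply mul_left_cancel₀ (pow_ne_zero 3 hx1)
  -- The left side of the goal is `-x / (1 - x) ^ 2`; the cube is the denominator of the quadratic
  -- sum `e3`.
  have e5 : (1 - x) ^ 3 * ((1 - (x + 1) / (x - 1) * ((x + 1) / (x - 1))) / 4) = -x * (1 - x) := by
    field_simp
    ring
  rw [e5]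
  have e6 : (1 / (2 * N) : ℂ) * (2 * N) = 1 := by field_simp
  linear_combination (-1 / (2 * N) : ℂ) * e3 + (1 - x) / 2 * e2 + (-x + x ^ 2 + x * (2 - N)
    + x ^ 2 * (-2 + N / 2) + N / 2) * e6

lemma sum_cotCoef {N : ℕ} (β : Fin N) : ∑ α : Fin N, cotCoef α β = 0 := by
  have hN : (N : ℂ) ≠ 0 := by
    have := β.isLt
    exact_mod_cast (show N ≠ 0 by omega)
  have h : ∑ α : Fin N, cotCoef α β = ∑ α : Fin N with α ≠ β, cotCoef α β := by
    symm
    refine Finset.sum_filter_of_ne fun α _ h1 h2 => h1 ?_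
    rw [h2, cotCoef_self]
  rw [h, Finset.sum_congr rfl (fun α hα => cotCoef_eq_modes (Finset.mem_filter.mp hα).2),
    Finset.sum_add_distrib, ← Finset.mul_sum, sum_modes_off_diag β _ (by simp), sum_range_cast]
  have h2 : (∑ α : Fin N with α ≠ β, (1 : ℂ)) = N - 1 := by
    rw [Finset.sum_const, Finset.filter_ne', Finset.card_erase_of_mem (Finset.mem_univ _),
      Finset.card_univ, Fintype.card_fin, nsmul_eq_mul, mul_one,
      Nat.cast_sub (by have := β.isLt; omega), Nat.cast_one]
  rw [h2]
  field_simp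
  ring

lemma sum_one_sub_cotCoef_sq {N : ℕ} (β : Fin N) :
    ∑ α : Fin N with α ≠ β, (1 - cotCoef α β * cotCoef α β) / 4 = ((N : ℂ) ^ 2 - 1) / 12 := by
  have hN : (N : ℂ) ≠ 0 := by
    have := β.isLt
    exact_mod_cast (show N ≠ 0 by omega)
  rw [Finset.sum_congr rfl
    (fun α hα => one_sub_cotCoef_sq_eq_modes (Finset.mem_filter.mp hα).2),
    sum_modes_off_diag β (fun k => (-(k * (N - k) / (2 * N)) : ℂ)) (by simp)]
  have e4 : ∑ k ∈ Finset.range N, (-(k * (N - k) / (2 * N)) : ℂ)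
      = (1 / (2 * N)) * ∑ k ∈ Finset.range N, (k : ℂ) ^ 2
        - (1 / 2) * ∑ k ∈ Finset.range N, (k : ℂ) := by
    rw [Finset.mul_sum, Finset.mul_sum, ← Finset.sum_sub_distrib]
    refine Finset.sum_congr rfl fun k _ => ?_
    field_simp
    ring
  rw [e4, sum_range_cast, sum_range_cast_sq]
  field_simp
  ring

/-- The coefficient of `𝐒_β · 𝐒_γ` after summation over the central site `α`. -/
lemma sum_pair_weight {N : ℕ} {β γ : Fin N} (h : β ≠ γ) :
    ∑ α : Fin N with β ≠ α ∧ γ ≠ α, (1 - cotCoef α β * cotCoef α γ) / 4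
      = 2 * ((1 - cotCoef β γ * cotCoef β γ) / 4) - 1 / 2 := by
  have h1 : ∀ α ∈ Finset.univ.filter (fun α : Fin N => β ≠ α ∧ γ ≠ α),
      (1 - cotCoef α β * cotCoef α γ) / 4 = -cotCoef β γ / 4 * (cotCoef α β - cotCoef α γ) := by
    intro α hα
    obtain ⟨hb, hc⟩ := (Finset.mem_filter.mp hα).2
    rw [cotCoef_mul_cotCoef hb.symm hc.symm h]
    ring
  rw [Finset.sum_congr rfl h1, ← Finset.mul_sum]
  -- Over all `α` the sum vanishes; the two omitted sites contribute `-θ_{βγ}` each.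
  have h2 : ∑ α : Fin N with β ≠ α ∧ γ ≠ α, (cotCoef α β - cotCoef α γ) = 2 * cotCoef β γ := by
    have h3 : ∑ α : Fin N, (cotCoef α β - cotCoef α γ) = 0 := by
      rw [Finset.sum_sub_distrib, sum_cotCoef, sum_cotCoef, sub_self]
    rw [← Finset.sum_filter_add_sum_filter_not Finset.univ (fun α => β ≠ α ∧ γ ≠ α)] at h3
    have h4 : Finset.univ.filter (fun α : Fin N => ¬(β ≠ α ∧ γ ≠ α)) = {β, γ} := by
      ext α
      simp only [Finset.mem_filter, Finset.mem_univ, true_and, Finset.mem_insert,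
        Finset.mem_singleton]
      constructor
      · intro h5
        by_contra h6
        push Not at h6
        exact h5 ⟨h6.1.symm, h6.2.symm⟩
      · rintro (rfl | rfl) <;> simp
    rw [h4, Finset.sum_pair h, cotCoef_self, cotCoef_self, cotCoef_swap β γ] at h3
    linear_combination h3
  rw [h2]
  ring

/-! ### Operators acting on one site -/

section OnSite

variable {N d : ℕ}

/-- Products of such operators become iterated `Function.update`, so multiplicativity and locality
reduce to `Function.update_idem` and `Function.update_comm`. -/
lemma onSite_mulVec (α : Fin N) (A : Matrix (Fin (d + 1)) (Fin (d + 1)) ℂ) (ψ : Ket N d)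
    (n : Config N d) :
    (onSite α A *ᵥ ψ) n = ∑ j, A (n α) j * ψ (Function.update n α j) := by
  have hinj : Function.Injective (fun j => Function.update n α j) :=
    Function.update_injective n α
  rw [Matrix.mulVec, dotProduct]
  have h : ∀ m : Config N d, m ∉ Finset.univ.map ⟨_, hinj⟩ → onSite α A n m * ψ m = 0 := by
    intro m hm
    have : ¬ ∀ β, β ≠ α → n β = m β := by
      intro h1
      apply hm
      rw [Finset.mem_map]
      refine ⟨m α, Finset.mem_univ _, ?_⟩
      funext β
      rcases eq_or_ne β α with rfl | hβ
      · simp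
      · simp [hβ, h1 β hβ]
    rw [onSite, Matrix.of_apply, if_neg this, zero_mul]
  rw [← Finset.sum_subset (Finset.subset_univ _) (fun m _ hm => h m hm), Finset.sum_map]
  refine Finset.sum_congr rfl fun j _ => ?_
  have h2 : ∀ β, β ≠ α → n β = Function.update n α j β := fun β hβ => by simp [hβ]
  simp only [Function.Embedding.coeFn_mk, onSite, Matrix.of_apply, if_pos h2,
    Function.update_self]

lemma op_ext {A B : Op N d} (h : ∀ ψ : Ket N d, A *ᵥ ψ = B *ᵥ ψ) : A = B :=
  Matrix.toLin'.injective (LinearMap.ext h)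

lemma onSite_add (α : Fin N) (A B : Matrix (Fin (d + 1)) (Fin (d + 1)) ℂ) :
    onSite α (A + B) = onSite α A + onSite α B := by
  ext n m
  simp only [onSite, Matrix.of_apply, Matrix.add_apply]
  split_ifs <;> simp

lemma onSite_smul (α : Fin N) (c : ℂ) (A : Matrix (Fin (d + 1)) (Fin (d + 1)) ℂ) :
    onSite α (c • A) = c • onSite α A := by
  ext n m
  simp only [onSite, Matrix.of_apply, Matrix.smul_apply]
  split_ifs <;> simp

lemma onSite_sub (α : Fin N) (A B : Matrix (Fin (d + 1)) (Fin (d + 1)) ℂ) :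
    onSite α (A - B) = onSite α A - onSite α B := by
  ext n m
  simp only [onSite, Matrix.of_apply, Matrix.sub_apply]
  split_ifs <;> simp

lemma onSite_one (α : Fin N) : onSite α (1 : Matrix (Fin (d + 1)) (Fin (d + 1)) ℂ) = 1 := by
  refine op_ext fun ψ => ?_
  funext n
  simp [onSite_mulVec, Matrix.one_apply]

lemma onSite_mul (α : Fin N) (A B : Matrix (Fin (d + 1)) (Fin (d + 1)) ℂ) :
    onSite α (A * B) = onSite α A * onSite α B := by
  refine op_ext fun ψ => ?_
  funext n
  rw [← Matrix.mulVec_mulVec]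
  simp only [onSite_mulVec, Function.update_self, Function.update_idem, Matrix.mul_apply,
    Finset.sum_mul, Finset.mul_sum, mul_assoc]
  rw [Finset.sum_comm]

lemma onSite_comm {α β : Fin N} (h : α ≠ β) (A B : Matrix (Fin (d + 1)) (Fin (d + 1)) ℂ) :
    onSite α A * onSite β B = onSite β B * onSite α A := by
  refine op_ext fun ψ => ?_
  funext n
  rw [← Matrix.mulVec_mulVec, ← Matrix.mulVec_mulVec]
  simp only [onSite_mulVec, Function.update_of_ne h, Function.update_of_ne h.symm,
    Finset.mul_sum]
  rw [Finset.sum_comm]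
  refine Finset.sum_congr rfl fun j _ => Finset.sum_congr rfl fun k _ => ?_
  rw [Function.update_comm h]
  ring

lemma onSite_conjTranspose (α : Fin N) (A : Matrix (Fin (d + 1)) (Fin (d + 1)) ℂ) :
    (onSite α A)ᴴ = onSite α Aᴴ := by
  ext n m
  simp only [onSite, Matrix.of_apply, Matrix.conjTranspose_apply]
  by_cases h : ∀ β, β ≠ α → n β = m β
  · rw [if_pos h, if_pos fun β hβ => (h β hβ).symm]
  · rw [if_neg h, if_neg fun h' => h fun β hβ => (h' β hβ).symm, star_zero]

end OnSite

/-! ### The spin algebra on one site -/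

section OneSpin

variable (d : ℕ)

lemma raising_mul_lowering :
    raising d * lowering d = Matrix.diagonal fun k : Fin (d + 1) =>
      ((d : ℂ) - ((k : ℕ) : ℂ) + 1) * ((k : ℕ) : ℂ) := by
  ext j k
  rw [Matrix.mul_apply, Matrix.diagonal_apply]
  simp only [lowering, raising, Matrix.conjTranspose_apply, Matrix.of_apply]
  -- The only intermediate state is `j - 1`. It is missing for `j = 0`, where the claimed diagonal
  -- entry vanishes too.
  rcases Nat.eq_zero_or_pos (j : ℕ) with hj | hj
  · rw [Finset.sum_eq_zero (fun i _ => by rw [if_neg (by omega), zero_mul])]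
    split_ifs with h
    · simp [hj]
    · rfl
  · have hjlt := j.isLt
    rw [Finset.sum_eq_single (⟨(j : ℕ) - 1, by omega⟩ : Fin (d + 1))]
    · rw [if_pos (by simp only []; omega)]
      by_cases h : j = k
      · subst h
        rw [if_pos (by simp only []; omega), if_pos rfl]
        simp only [RCLike.star_def, Complex.conj_ofReal]
        rw [← Complex.ofReal_mul, Real.mul_self_sqrt]
        · rw [Nat.cast_sub (by omega)]
          push_cast
          ring
        · have h1 : ((j : ℕ) : ℝ) - 1 ≤ d := by
            have : ((j : ℕ) : ℝ) < d + 1 := by exact_mod_cast hjlt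
            linarith
          rw [Nat.cast_sub (by omega)]
          apply mul_nonneg
          · push_cast; linarith
          · push_cast; linarith [Nat.cast_nonneg (α := ℝ) (j : ℕ)]
      · rw [if_neg (fun e => h (Fin.ext (by simp only [] at e; omega))), if_neg h, star_zero,
          mul_zero]
    · intro i _ hi
      rw [if_neg (fun e => hi (Fin.ext (by simp only []; omega))), zero_mul]
    · simp

lemma lowering_mul_raising :
    lowering d * raising d = Matrix.diagonal fun k : Fin (d + 1) =>
      ((d : ℂ) - ((k : ℕ) : ℂ)) * (((k : ℕ) : ℂ) + 1) := by
  ext j k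
  rw [Matrix.mul_apply, Matrix.diagonal_apply]
  simp only [lowering, raising, Matrix.conjTranspose_apply, Matrix.of_apply]
  have hjlt := j.isLt
  by_cases hj : (j : ℕ) = d
  · rw [Finset.sum_eq_zero (fun i _ => by
      have := i.isLt
      rw [if_neg (by omega), star_zero, zero_mul])]
    split_ifs with h
    · simp [hj]
    · rfl
  · rw [Finset.sum_eq_single (⟨(j : ℕ) + 1, by omega⟩ : Fin (d + 1))]
    · rw [if_pos (by simp only [])]
      by_cases h : j = k
      · subst h
        rw [if_pos (by simp only []), if_pos rfl]
        simp only [RCLike.star_def, Complex.conj_ofReal]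
        rw [← Complex.ofReal_mul, Real.mul_self_sqrt]
        · push_cast
          ring
        · have h1 : ((j : ℕ) : ℝ) ≤ d := by exact_mod_cast Nat.lt_succ_iff.mp hjlt
          apply mul_nonneg <;> linarith [Nat.cast_nonneg (α := ℝ) (j : ℕ)]
      · rw [if_neg (fun e => h (Fin.ext (by simp only [] at e; omega))), if_neg h, mul_zero]
    · intro i _ hi
      rw [if_neg (fun e => hi (Fin.ext (by simp only []; omega))), star_zero, zero_mul]
    · simp

lemma spinOne_two : spinOne d 2 = Matrix.diagonal fun k : Fin (d + 1) => (((k : ℕ) : ℂ) - (d : ℂ) / 2) := by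
  simp [spinOne, spinS]

lemma spinOne_two_mul_raising :
    spinOne d 2 * raising d - raising d * spinOne d 2 = raising d := by
  ext j k
  rw [spinOne_two, Matrix.sub_apply, Matrix.diagonal_mul, Matrix.mul_diagonal]
  simp only [raising, Matrix.of_apply]
  split_ifs with h
  · rw [h]
    push_cast
    ring
  · simp

lemma spinOne_conjTranspose (i : Fin 3) : (spinOne d i)ᴴ = spinOne d i := by
  fin_cases i
  · simp [spinOne, lowering, Matrix.conjTranspose_smul, add_comm]
  · change ((1 / (2 * Complex.I) : ℂ) • (raising d - lowering d))ᴴ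
      = (1 / (2 * Complex.I) : ℂ) • (raising d - lowering d)
    have h : star (1 / (2 * Complex.I) : ℂ) = -(1 / (2 * Complex.I)) := by
      simp
    rw [Matrix.conjTranspose_smul, h, Matrix.conjTranspose_sub, lowering,
      Matrix.conjTranspose_conjTranspose, neg_smul, ← smul_neg, neg_sub]
  · change (spinOne d 2)ᴴ = spinOne d 2
    rw [spinOne_two, Matrix.diagonal_conjTranspose]
    congr 1
    funext k
    simp

lemma lowering_mul_spinOne_two :
    lowering d * spinOne d 2 - spinOne d 2 * lowering d = lowering d := by
  have h := congrArg Matrix.conjTranspose (spinOne_two_mul_raising d)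
  rwa [Matrix.conjTranspose_sub, Matrix.conjTranspose_mul, Matrix.conjTranspose_mul,
    spinOne_conjTranspose] at h

lemma raising_commutator_lowering :
    raising d * lowering d - lowering d * raising d = (2 : ℂ) • spinOne d 2 := by
  rw [raising_mul_lowering, lowering_mul_raising, spinOne_two, Matrix.diagonal_sub,
    ← Matrix.diagonal_smul]
  congr 1
  funext k
  simp
  ring

/-- Twice the Casimir operator in ladder form: `d (d + 2) / 2 = 2 S (S + 1)` for `S = d / 2`. -/
lemma raising_anticommutator_lowering :
    raising d * lowering d + lowering d * raising d + (2 : ℂ) • (spinOne d 2 * spinOne d 2)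
      = ((d : ℂ) * (d + 2) / 2) • 1 := by
  rw [raising_mul_lowering, lowering_mul_raising, spinOne_two, Matrix.diagonal_mul_diagonal,
    ← Matrix.diagonal_smul, Matrix.diagonal_add, Matrix.diagonal_add, ← Matrix.diagonal_one,
    ← Matrix.diagonal_smul]
  congr 1
  funext k
  simp
  ring

lemma spinOne_zero : spinOne d 0 = (1 / 2 : ℂ) • (raising d + lowering d) := rfl

lemma spinOne_one : spinOne d 1 = (1 / (2 * Complex.I) : ℂ) • (raising d - lowering d) := rfl

lemma one_div_two_I : (1 / (2 * Complex.I) : ℂ) = -(Complex.I / 2) := by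
  rw [div_eq_iff (by simp)]
  linear_combination Complex.I_mul_I

lemma spinOne_comm01 :
    spinOne d 0 * spinOne d 1 - spinOne d 1 * spinOne d 0 = Complex.I • spinOne d 2 := by
  have h := raising_commutator_lowering d
  have h' : spinOne d 2 = (1 / 2 : ℂ) • (raising d * lowering d - lowering d * raising d) := by
    rw [h, smul_smul]; norm_num
  rw [h', spinOne_zero, spinOne_one, one_div_two_I]
  simp only [smul_mul_smul_comm, add_mul, mul_add, sub_mul, mul_sub]
  module

lemma spinOne_comm12 :
    spinOne d 1 * spinOne d 2 - spinOne d 2 * spinOne d 1 = Complex.I • spinOne d 0 := by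
  have h1 := spinOne_two_mul_raising d
  have h2 := lowering_mul_spinOne_two d
  rw [spinOne_zero, spinOne_one, one_div_two_I]
  simp only [smul_mul_assoc, mul_smul_comm, sub_mul, mul_sub]
  linear_combination (norm := module) (Complex.I / 2) • h1 + (Complex.I / 2) • h2

lemma spinOne_comm20 :
    spinOne d 2 * spinOne d 0 - spinOne d 0 * spinOne d 2 = Complex.I • spinOne d 1 := by
  have h1 := spinOne_two_mul_raising d
  have h2 := lowering_mul_spinOne_two d
  have hI : Complex.I * -(Complex.I / 2) = 1 / 2 := by linear_combination (-1/2 : ℂ) * Complex.I_mul_I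
  rw [spinOne_zero, spinOne_one, one_div_two_I, smul_smul, hI]
  simp only [smul_mul_assoc, mul_smul_comm, add_mul, mul_add]
  linear_combination (norm := module) (1 / 2 : ℂ) • h1 - (1 / 2 : ℂ) • h2

lemma spinOne_casimir :
    spinOne d 0 * spinOne d 0 + spinOne d 1 * spinOne d 1 + spinOne d 2 * spinOne d 2
      = ((spinS d : ℂ) * (spinS d + 1)) • 1 := by
  have h := raising_anticommutator_lowering d
  have h1 : ((spinS d : ℂ) * (spinS d + 1)) • (1 : Matrix (Fin (d + 1)) (Fin (d + 1)) ℂ)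
      = (1 / 2 : ℂ) • (((d : ℂ) * (d + 2) / 2) • 1) := by
    rw [smul_smul]
    congr 1
    simp [spinS]
    ring
  have hI : -(Complex.I / 2) * -(Complex.I / 2) = (-1 / 4 : ℂ) := by
    linear_combination (1 / 4 : ℂ) * Complex.I_mul_I
  rw [h1, ← h, spinOne_zero, spinOne_one, one_div_two_I]
  simp only [smul_mul_smul_comm, hI, add_mul, mul_add, sub_mul, mul_sub]
  module

end OneSpin

/-! ### Spin operators of the chain -/

section Spin

variable {N : ℕ} (d : ℕ) (α : Fin N)

lemma spin_conjTranspose (i : Fin 3) : (spin d α i)ᴴ = spin d α i := by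
  rw [spin, onSite_conjTranspose, spinOne_conjTranspose]

lemma spin_comm {α β : Fin N} (h : α ≠ β) (i j : Fin 3) : Commute (spin d α i) (spin d β j) :=
  onSite_comm h _ _

lemma spin_comm01 :
    spin d α 0 * spin d α 1 - spin d α 1 * spin d α 0 = Complex.I • spin d α 2 := by
  simp only [spin, ← onSite_mul, ← onSite_sub, spinOne_comm01, onSite_smul]

lemma spin_comm12 :
    spin d α 1 * spin d α 2 - spin d α 2 * spin d α 1 = Complex.I • spin d α 0 := by
  simp only [spin, ← onSite_mul, ← onSite_sub, spinOne_comm12, onSite_smul]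

lemma spin_comm20 :
    spin d α 2 * spin d α 0 - spin d α 0 * spin d α 2 = Complex.I • spin d α 1 := by
  simp only [spin, ← onSite_mul, ← onSite_sub, spinOne_comm20, onSite_smul]

lemma spin_casimir : spin d α ⬝ᵥ spin d α = ((spinS d : ℂ) * (spinS d + 1)) • 1 := by
  simp only [dotProduct, Fin.sum_univ_three, spin, ← onSite_mul, ← onSite_add, spinOne_casimir,
    onSite_smul, onSite_one]

end Spin

/-! ### The projection of `1 ⊗ s` onto spin `s + 1` -/

section VectorOperators

variable {R : Type*} [Ring R] [Algebra ℂ R]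

/-- The matrix of the operation `V ↦ i 𝐒 × V` on vector operators. -/
noncomputable def crossMatrix (S : Fin 3 → R) : Matrix (Fin 3) (Fin 3) R :=
  !![0, -(Complex.I • S 2), Complex.I • S 1;
     Complex.I • S 2, 0, -(Complex.I • S 0);
     -(Complex.I • S 1), Complex.I • S 0, 0]

/-- The matrix `(2s + 1)` times the projection of spin `1 ⊗ s` onto spin `s + 1`. -/
noncomputable def topMatrix (s : ℂ) (S : Fin 3 → R) : Matrix (Fin 3) (Fin 3) R :=
  crossMatrix S + (s + 1) • (1 : Matrix (Fin 3) (Fin 3) R)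
    - (1 / (s + 1)) • Matrix.vecMulVec S S

/-- The relations of the spin operators of a spin `s`. -/
structure IsSpin (s : ℂ) (S : Fin 3 → R) : Prop where
  comm01 : S 0 * S 1 - S 1 * S 0 = Complex.I • S 2
  comm12 : S 1 * S 2 - S 2 * S 1 = Complex.I • S 0
  comm20 : S 2 * S 0 - S 0 * S 2 = Complex.I • S 1
  casimir : S ⬝ᵥ S = (s * (s + 1)) • 1

lemma I_smul_I_smul (x : R) : Complex.I • Complex.I • x = -x := by
  rw [smul_smul, Complex.I_mul_I, neg_smul, one_smul]

variable {s : ℂ} {S : Fin 3 → R}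

/-- `crossMatrix` is `𝐭 · 𝐒` with `𝐭` the spin-one generators in the Cartesian basis, with values
`s`, `-1`, `-(s + 1)` on total spin `s + 1`, `s`, `s - 1`. Entrywise, the diagonal is the Casimir
relation and the off-diagonal entries are the commutators. -/
lemma crossMatrix_mul_self (h : IsSpin s S) :
    crossMatrix S * crossMatrix S
      = (s * (s + 1)) • 1 - Matrix.vecMulVec S S - crossMatrix S := by
  have h1 := h.comm01
  have h2 := h.comm12
  have h3 := h.comm20
  have h4 := h.casimir
  simp only [dotProduct, Fin.sum_univ_three] at h4
  ext i j
  fin_cases i <;> fin_cases j <;>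
    simp [Matrix.mul_apply, Fin.sum_univ_three, crossMatrix, Matrix.vecMulVec_apply,
      I_smul_I_smul] <;>
    first
    | linear_combination (norm := module) h1
    | linear_combination (norm := module) -h1
    | linear_combination (norm := module) h2
    | linear_combination (norm := module) -h2
    | linear_combination (norm := module) h3
    | linear_combination (norm := module) -h3
    | linear_combination (norm := module) h4

/-- This is `𝐒 × 𝐒 = i 𝐒`. -/
lemma crossMatrix_mulVec_self (h : IsSpin s S) : crossMatrix S *ᵥ S = -S := by
  funext i
  fin_cases i <;>
    simp [Matrix.mulVec, dotProduct, Fin.sum_univ_three, crossMatrix]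
  · rw [← I_smul_I_smul (S 0), ← h.comm12]; module
  · rw [← I_smul_I_smul (S 1), ← h.comm20]; module
  · rw [← I_smul_I_smul (S 2), ← h.comm01]; module

lemma vecMul_crossMatrix_self (h : IsSpin s S) : S ᵥ* crossMatrix S = -S := by
  funext i
  fin_cases i <;>
    simp [Matrix.vecMul, dotProduct, Fin.sum_univ_three, crossMatrix]
  · rw [← I_smul_I_smul (S 0), ← h.comm12]; module
  · rw [← I_smul_I_smul (S 1), ← h.comm20]; module
  · rw [← I_smul_I_smul (S 2), ← h.comm01]; module

lemma vecMulVec_mulVec_eq {R : Type*} [Ring R] (u v w : Fin 3 → R) (i : Fin 3) :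
    (Matrix.vecMulVec u v *ᵥ w) i = u i * (v ⬝ᵥ w) := by
  simp only [Matrix.mulVec, dotProduct, Matrix.vecMulVec_apply, Finset.mul_sum, mul_assoc]

lemma topMatrix_mulVec_self (hs : s + 1 ≠ 0) (h : IsSpin s S) : topMatrix s S *ᵥ S = 0 := by
  funext i
  rw [topMatrix, Matrix.sub_mulVec, Matrix.add_mulVec, crossMatrix_mulVec_self h,
    Matrix.smul_mulVec, Matrix.smul_mulVec, Matrix.one_mulVec]
  simp only [Pi.sub_apply, Pi.add_apply, Pi.neg_apply, Pi.smul_apply, vecMulVec_mulVec_eq,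
    h.casimir, mul_smul_comm, mul_one, smul_smul, Pi.zero_apply]
  have e : 1 / (s + 1) * (s * (s + 1)) = s := by field_simp
  rw [e]
  module

/-- `vecMulVec S S` is `s (s + 1)` on total spin `s` and zero on the other two components; with the
values of `crossMatrix`, `topMatrix` is `2s + 1`, `0`, `0` on total spin `s + 1`, `s`, `s - 1`. The
proof verifies this from the products of the two matrices. -/
lemma topMatrix_mul_self (hs : s + 1 ≠ 0) (h : IsSpin s S) :
    topMatrix s S * topMatrix s S = (2 * s + 1) • topMatrix s S := by
  have hA := crossMatrix_mul_self h
  have hAP : crossMatrix S * Matrix.vecMulVec S S = -Matrix.vecMulVec S S := by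
    rw [Matrix.mul_vecMulVec, crossMatrix_mulVec_self h, Matrix.neg_vecMulVec]
  have hPA : Matrix.vecMulVec S S * crossMatrix S = -Matrix.vecMulVec S S := by
    rw [Matrix.vecMulVec_mul, vecMul_crossMatrix_self h, Matrix.vecMulVec_neg]
  have hPP : Matrix.vecMulVec S S * Matrix.vecMulVec S S
      = (s * (s + 1)) • Matrix.vecMulVec S S := by
    ext i j
    simp only [Matrix.mul_apply, Matrix.vecMulVec_apply, Matrix.smul_apply]
    have : ∑ k, S i * S k * (S k * S j) = S i * (S ⬝ᵥ S) * S j := by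
      simp only [dotProduct, Finset.mul_sum, Finset.sum_mul, mul_assoc]
    rw [this, h.casimir, mul_smul_comm, mul_one, smul_mul_assoc]
  set A := crossMatrix S with hAdef
  set P := Matrix.vecMulVec S S
  have e : topMatrix s S * topMatrix s S
      = A * A + ((s + 1) * 2) • A + ((s + 1) * (s + 1)) • (1 : Matrix (Fin 3) (Fin 3) R)
        - (1 / (s + 1)) • (A * P + P * A) - (2 * ((s + 1) * (1 / (s + 1)))) • P
        + (1 / (s + 1) * (1 / (s + 1))) • (P * P) := by
    rw [topMatrix, ← hAdef]
    simp only [add_mul, mul_add, sub_mul, mul_sub, smul_mul_assoc, mul_smul_comm, one_mul,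
      mul_one]
    module
  have e1 : (s + 1) * (1 / (s + 1)) = 1 := by field_simp
  have e2 : 1 / (s + 1) * (1 / (s + 1)) * (s * (s + 1)) = 1 - 1 / (s + 1) := by
    field_simp
    ring
  have e3 : (2 * s + 1) * (1 / (s + 1)) = 2 - 1 / (s + 1) := by
    field_simp
    ring
  rw [e, hA, hAP, hPA, hPP, smul_smul, e1, e2, topMatrix, smul_sub, smul_smul _ (1 / (s + 1)), e3]
  module

/-- The sesquilinear form of `topMatrix` on vector operators that commute with `𝐒`. -/
lemma topMatrix_form (V W : Fin 3 → R) (hV : ∀ i j, Commute (S i) (V j)) :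
    V ⬝ᵥ (topMatrix s S *ᵥ W)
      = V ⬝ᵥ (crossMatrix S *ᵥ W) + (s + 1) • (V ⬝ᵥ W)
        - (1 / (s + 1)) • ((S ⬝ᵥ V) * (S ⬝ᵥ W)) := by
  have h1 : V ⬝ᵥ (Matrix.vecMulVec S S *ᵥ W) = (S ⬝ᵥ V) * (S ⬝ᵥ W) := by
    simp only [dotProduct, vecMulVec_mulVec_eq]
    rw [Finset.sum_mul]
    refine Finset.sum_congr rfl fun i _ => ?_
    rw [(hV i i).eq, mul_assoc]
  rw [topMatrix, Matrix.sub_mulVec, Matrix.add_mulVec, Matrix.smul_mulVec, Matrix.smul_mulVec,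
    Matrix.one_mulVec, dotProduct_sub, dotProduct_add, dotProduct_smul, dotProduct_smul, h1]

/-- A triple product of mutually commuting vectors changes sign when `V` and `W` are exchanged. -/
lemma crossMatrix_form_add (V W : Fin 3 → R) (hV : ∀ i j, Commute (S i) (V j))
    (hW : ∀ i j, Commute (S i) (W j)) (hVW : ∀ i j, Commute (V i) (W j)) :
    V ⬝ᵥ (crossMatrix S *ᵥ W) + W ⬝ᵥ (crossMatrix S *ᵥ V) = 0 := by
  have hl : ∀ i j k, W i * (S j * V k) = V k * (S j * W i) := fun i j k => by
    rw [(hV j k).eq, ← mul_assoc, ← (hVW k i).eq, mul_assoc, (hW j i).eq]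
  simp [Matrix.mulVec, dotProduct, Fin.sum_univ_three, crossMatrix, mul_add, hl]
  module

/-- The triple product with a repeated spin survives, because `𝐕 × 𝐕 = i 𝐕`. This is the source of
the extra two-spin term at `β = γ`. -/
lemma crossMatrix_form_self (V : Fin 3 → R) (hV : ∀ i j, Commute (S i) (V j))
    {t : ℂ} (h : IsSpin t V) :
    V ⬝ᵥ (crossMatrix S *ᵥ V) = S ⬝ᵥ V := by
  have h0 : V 0 = -(Complex.I • (V 1 * V 2 - V 2 * V 1)) := by rw [h.comm12, I_smul_I_smul, neg_neg]
  have h1 : V 1 = -(Complex.I • (V 2 * V 0 - V 0 * V 2)) := by rw [h.comm20, I_smul_I_smul, neg_neg]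
  have h2 : V 2 = -(Complex.I • (V 0 * V 1 - V 1 * V 0)) := by rw [h.comm01, I_smul_I_smul, neg_neg]
  have e0 : S 0 * V 0 = S 0 * -(Complex.I • (V 1 * V 2 - V 2 * V 1)) := congrArg (S 0 * ·) h0
  have e1 : S 1 * V 1 = S 1 * -(Complex.I • (V 2 * V 0 - V 0 * V 2)) := congrArg (S 1 * ·) h1
  have e2 : S 2 * V 2 = S 2 * -(Complex.I • (V 0 * V 1 - V 1 * V 0)) := congrArg (S 2 * ·) h2
  have hl : ∀ i j k, V i * (S j * V k) = S j * (V i * V k) := fun i j k => by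
    rw [← mul_assoc, ← (hV j i).eq, mul_assoc]
  rw [dotProduct, dotProduct, Fin.sum_univ_three, Fin.sum_univ_three, e0, e1, e2]
  simp [Matrix.mulVec, dotProduct, Fin.sum_univ_three, crossMatrix, mul_add, mul_sub, hl]
  module

end VectorOperators

/-! ### The operators `𝐃_α` and `𝐁_α` through the projection -/

section Chain

variable {N : ℕ} (d : ℕ)

lemma spinS_add_one_ne_zero : (spinS d : ℂ) + 1 ≠ 0 := by
  have : (0 : ℝ) < spinS d + 1 := by
    have : (0 : ℝ) ≤ (d : ℝ) := Nat.cast_nonneg d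
    rw [spinS]
    linarith
  exact_mod_cast this.ne'

lemma isSpin_spin (α : Fin N) : IsSpin (spinS d : ℂ) (spin d α) where
  comm01 := spin_comm01 d α
  comm12 := spin_comm12 d α
  comm20 := spin_comm20 d α
  casimir := spin_casimir d α

/-- `topMatrix` for the spin of site `α`. -/
noncomputable def siteMatrix (α : Fin N) : Matrix (Fin 3) (Fin 3) (Op N d) :=
  topMatrix (spinS d : ℂ) (spin d α)

lemma bracket_eq_mulVec (α β : Fin N) : bracket d α β = siteMatrix d α *ᵥ spin d β := by
  funext i
  rw [siteMatrix, topMatrix, Matrix.sub_mulVec, Matrix.add_mulVec, Matrix.smul_mulVec,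
    Matrix.smul_mulVec, Matrix.one_mulVec]
  simp only [Pi.sub_apply, Pi.add_apply, Pi.smul_apply, vecMulVec_mulVec_eq, bracket]
  congr 2
  fin_cases i <;>
    simp [Matrix.mulVec, dotProduct, Fin.sum_univ_three, crossMatrix, opCross] <;> module

lemma bracket_self (α : Fin N) : bracket d α α = 0 := by
  rw [bracket_eq_mulVec, siteMatrix,
    topMatrix_mulVec_self (spinS_add_one_ne_zero d) (isSpin_spin d α)]

lemma opD_eq_mulVec (α : Fin N) :
    opD d α = siteMatrix d α *ᵥ ((1 / 2 : ℂ) • ∑ β with β ≠ α, cotCoef α β • spin d β) := by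
  rw [Matrix.mulVec_smul, Matrix.mulVec_sum]
  simp_rw [Matrix.mulVec_smul, ← bracket_eq_mulVec]
  funext i
  rw [opD, Pi.smul_apply, Finset.sum_apply]
  rfl

lemma opB_eq_mulVec (α : Fin N) :
    opB d α = siteMatrix d α *ᵥ ((Complex.I / 2 : ℂ) • ∑ β with β ≠ α, spin d β) := by
  rw [Matrix.mulVec_smul, Matrix.mulVec_sum]
  simp_rw [← bracket_eq_mulVec]
  funext i
  rw [opB, Pi.smul_apply, Finset.sum_apply]

/-- Since `M_α 𝐒_α = 0`, the missing term `β = α` can be added for free; hence every singlet is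
annihilated by `𝐁_α`. -/
lemma opB_eq_mulVec_spinTot (α : Fin N) :
    opB d α = siteMatrix d α *ᵥ ((Complex.I / 2 : ℂ) • spinTot N d) := by
  have h : spinTot N d = ∑ β : Fin N with β ≠ α, spin d β + spin d α := by
    funext i
    rw [Finset.filter_ne', Finset.sum_erase_add _ _ (Finset.mem_univ α), Finset.sum_apply]
    rfl
  rw [opB_eq_mulVec, h, smul_add, Matrix.mulVec_add, Matrix.mulVec_smul _ _ (spin d α),
    ← bracket_eq_mulVec, bracket_self, smul_zero, add_zero]

lemma siteMatrix_conjTranspose (α : Fin N) (i j : Fin 3) :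
    (siteMatrix d α i j)ᴴ = siteMatrix d α j i := by
  have hs : star (spinS d : ℂ) = (spinS d : ℂ) := Complex.conj_ofReal _
  simp only [siteMatrix, topMatrix, Matrix.sub_apply, Matrix.add_apply, Matrix.smul_apply,
    Matrix.vecMulVec_apply, Matrix.conjTranspose_sub, Matrix.conjTranspose_add,
    Matrix.conjTranspose_smul, Matrix.conjTranspose_mul, spin_conjTranspose]
  have h1 : star ((spinS d : ℂ) + 1) = (spinS d : ℂ) + 1 := by rw [star_add, hs, star_one]
  have h2 : star (1 / ((spinS d : ℂ) + 1)) = 1 / ((spinS d : ℂ) + 1) := by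
    rw [star_div₀, h1, star_one]
  rw [h1, h2]
  congr 2
  · fin_cases i <;> fin_cases j <;>
      simp [crossMatrix, Matrix.conjTranspose_smul, spin_conjTranspose]
  · congr 1
    by_cases h : i = j
    · subst h; simp
    · rw [Matrix.one_apply_ne h, Matrix.one_apply_ne (Ne.symm h), Matrix.conjTranspose_zero]

/-- `M_α` is Hermitian and `M_α² = (2S+1) M_α`, so the form that is quadratic in `M_α` becomes
linear in it. -/
lemma normSqOp_siteMatrix_mulVec (α : Fin N) (V : Fin 3 → Op N d) :
    normSqOp (siteMatrix d α *ᵥ V)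
      = (2 * (spinS d : ℂ) + 1) • ((fun i => (V i)ᴴ) ⬝ᵥ (siteMatrix d α *ᵥ V)) := by
  have h : (fun i => (V i)ᴴ) ⬝ᵥ (siteMatrix d α *ᵥ (siteMatrix d α *ᵥ V))
      = normSqOp (siteMatrix d α *ᵥ V) := by
    rw [Matrix.dotProduct_mulVec, normSqOp, dotProduct]
    refine Finset.sum_congr rfl fun i _ => ?_
    congr 1
    simp only [Matrix.vecMul, Matrix.mulVec, dotProduct, Matrix.conjTranspose_sum,
      Matrix.conjTranspose_mul, siteMatrix_conjTranspose]
  rw [← h, Matrix.mulVec_mulVec, siteMatrix,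
    topMatrix_mul_self (spinS_add_one_ne_zero d) (isSpin_spin d α), Matrix.smul_mulVec,
    dotProduct_smul]

end Chain

/-! ### The factorization of the Hamiltonian -/

section Factorization

variable {N : ℕ} (d : ℕ)

lemma spin_dotProduct_comm (β γ : Fin N) : spin d β ⬝ᵥ spin d γ = spin d γ ⬝ᵥ spin d β := by
  rcases eq_or_ne β γ with rfl | h
  · rfl
  · exact Finset.sum_congr rfl fun i _ => (spin_comm d h i i).eq

/-- `(1 - θ_{αβ} θ_{αγ}) / 4`, which is `1 / |η_α - η_β|²` for `β = γ`. -/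
noncomputable def pairWeight (α β γ : Fin N) : ℂ := (1 - cotCoef α β * cotCoef α γ) / 4

lemma pairWeight_comm (α β γ : Fin N) : pairWeight α β γ = pairWeight α γ β := by
  rw [pairWeight, pairWeight, mul_comm]

lemma symm_sum_eq {ι M : Type*} [AddCommGroup M] [Module ℂ M] (s : Finset ι) (c : ι → ι → ℂ)
    (q : ι → ι → M) (hc : ∀ i j, c i j = c j i) :
    ∑ i ∈ s, ∑ j ∈ s, c i j • q i j
      = ∑ i ∈ s, ∑ j ∈ s, c i j • ((1 / 2 : ℂ) • (q i j + q j i)) := by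
  have h : ∑ i ∈ s, ∑ j ∈ s, c i j • q j i = ∑ i ∈ s, ∑ j ∈ s, c i j • q i j := by
    rw [Finset.sum_comm]
    simp_rw [hc]
  have h2 : ∑ i ∈ s, ∑ j ∈ s, c i j • ((1 / 2 : ℂ) • (q i j + q j i))
      = (1 / 2 : ℂ) • (∑ i ∈ s, ∑ j ∈ s, c i j • q i j + ∑ i ∈ s, ∑ j ∈ s, c i j • q j i) := by
    simp_rw [smul_comm _ (1 / 2 : ℂ), ← Finset.smul_sum, smul_add, Finset.sum_add_distrib,
      smul_add]
  rw [h2, h, ← two_smul ℂ, smul_smul]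
  norm_num

lemma normSqOp_opD (α : Fin N) :
    normSqOp (opD d α) = (2 * (spinS d : ℂ) + 1) •
      ∑ β : Fin N with β ≠ α, ∑ γ : Fin N with γ ≠ α,
        (-(cotCoef α β * cotCoef α γ) / 4) • (spin d β ⬝ᵥ (siteMatrix d α *ᵥ spin d γ)) := by
  rw [opD_eq_mulVec, normSqOp_siteMatrix_mulVec]
  have h : (fun i => (((1 / 2 : ℂ) • ∑ β with β ≠ α, cotCoef α β • spin d β) i)ᴴ)
      = (-(1 / 2) : ℂ) • ∑ β with β ≠ α, cotCoef α β • spin d β := by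
    funext i
    simp only [Pi.smul_apply, Finset.sum_apply, Matrix.conjTranspose_smul,
      Matrix.conjTranspose_sum, spin_conjTranspose, RCLike.star_def, conj_cotCoef, neg_smul,
      Finset.sum_neg_distrib, smul_neg]
    simp [map_ofNat]
  rw [h, Matrix.mulVec_smul, dotProduct_smul, smul_dotProduct, smul_smul, Matrix.mulVec_sum,
    sum_dotProduct]
  simp_rw [dotProduct_sum, Matrix.mulVec_smul, dotProduct_smul, smul_dotProduct, Finset.smul_sum,
    smul_smul]
  refine Finset.sum_congr rfl fun β _ => Finset.sum_congr rfl fun γ _ => ?_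
  congr 1
  ring

lemma normSqOp_opB (α : Fin N) :
    normSqOp (opB d α) = (2 * (spinS d : ℂ) + 1) •
      ∑ β : Fin N with β ≠ α, ∑ γ : Fin N with γ ≠ α,
        (1 / 4 : ℂ) • (spin d β ⬝ᵥ (siteMatrix d α *ᵥ spin d γ)) := by
  rw [opB_eq_mulVec, normSqOp_siteMatrix_mulVec]
  have h : (fun i => (((Complex.I / 2 : ℂ) • ∑ β with β ≠ α, spin d β) i)ᴴ)
      = (-(Complex.I / 2) : ℂ) • ∑ β with β ≠ α, spin d β := by
    funext i
    simp only [Pi.smul_apply, Finset.sum_apply, Matrix.conjTranspose_smul,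
      Matrix.conjTranspose_sum, spin_conjTranspose]
    simp [neg_div]
  have hI : Complex.I / 2 * -(Complex.I / 2) = 1 / 4 := by
    linear_combination (-1 / 4 : ℂ) * Complex.I_mul_I
  rw [h, Matrix.mulVec_smul, dotProduct_smul, smul_dotProduct, smul_smul (Complex.I / 2), hI,
    Matrix.mulVec_sum, sum_dotProduct]
  simp_rw [dotProduct_sum, Finset.smul_sum]

/-- The weight is symmetric in `β, γ`, so only this symmetrization matters. The three terms come
from the three summands of `M_α`; the first survives only on the diagonal. -/
lemma half_siteMatrix_form_add {α β γ : Fin N} (hβ : β ≠ α) (hγ : γ ≠ α) :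
    (1 / 2 : ℂ) • (spin d β ⬝ᵥ (siteMatrix d α *ᵥ spin d γ)
        + spin d γ ⬝ᵥ (siteMatrix d α *ᵥ spin d β))
      = (if β = γ then spin d α ⬝ᵥ spin d β else 0)
        + ((spinS d : ℂ) + 1) • (spin d β ⬝ᵥ spin d γ)
        - (1 / (2 * ((spinS d : ℂ) + 1))) •
          ((spin d α ⬝ᵥ spin d β) * (spin d α ⬝ᵥ spin d γ)
            + (spin d α ⬝ᵥ spin d γ) * (spin d α ⬝ᵥ spin d β)) := by
  have hb := spin_comm d hβ.symm
  have hc := spin_comm d hγ.symm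
  have e : 1 / (2 * ((spinS d : ℂ) + 1)) = (1 / 2) * (1 / ((spinS d : ℂ) + 1)) := by
    rw [one_div_mul_one_div]
  have hcross : (1 / 2 : ℂ) • (spin d β ⬝ᵥ (crossMatrix (spin d α) *ᵥ spin d γ)
        + spin d γ ⬝ᵥ (crossMatrix (spin d α) *ᵥ spin d β))
      = if β = γ then spin d α ⬝ᵥ spin d β else 0 := by
    split_ifs with h
    · subst h
      rw [crossMatrix_form_self (spin d β) hb (isSpin_spin d β), ← two_smul ℂ, smul_smul]
      norm_num
    · rw [crossMatrix_form_add _ _ hb hc (spin_comm d h), smul_zero]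
  rw [siteMatrix, topMatrix_form _ _ hb, topMatrix_form _ _ hc, ← hcross,
    spin_dotProduct_comm d γ β, e]
  module

lemma normSqOp_opD_add_opB (α : Fin N) :
    normSqOp (opD d α) + normSqOp (opB d α) = (2 * (spinS d : ℂ) + 1) •
      (∑ β : Fin N with β ≠ α, pairWeight α β β • (spin d α ⬝ᵥ spin d β)
        + ((spinS d : ℂ) + 1) • ∑ β : Fin N with β ≠ α, ∑ γ : Fin N with γ ≠ α,
            pairWeight α β γ • (spin d β ⬝ᵥ spin d γ)
        - (1 / (2 * ((spinS d : ℂ) + 1))) •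
          ∑ β : Fin N with β ≠ α, ∑ γ : Fin N with γ ≠ α, pairWeight α β γ •
            ((spin d α ⬝ᵥ spin d β) * (spin d α ⬝ᵥ spin d γ)
              + (spin d α ⬝ᵥ spin d γ) * (spin d α ⬝ᵥ spin d β))) := by
  rw [normSqOp_opD, normSqOp_opB, ← smul_add]
  congr 1
  have h1 : ∀ β γ : Fin N, -(cotCoef α β * cotCoef α γ) / 4 + 1 / 4 = pairWeight α β γ :=
    fun β γ => by rw [pairWeight]; ring
  simp_rw [← Finset.sum_add_distrib, ← add_smul, h1]
  rw [symm_sum_eq _ _ _ (pairWeight_comm α)]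
  have h2 : ∑ β : Fin N with β ≠ α, pairWeight α β β • (spin d α ⬝ᵥ spin d β)
      = ∑ β : Fin N with β ≠ α, ∑ γ : Fin N with γ ≠ α,
          pairWeight α β γ • (if β = γ then spin d α ⬝ᵥ spin d β else 0) := by
    refine Finset.sum_congr rfl fun β hβ => ?_
    simp_rw [smul_ite, smul_zero]
    rw [Finset.sum_ite_eq, if_pos hβ]
  rw [h2]
  simp_rw [Finset.smul_sum, ← Finset.sum_add_distrib, ← Finset.sum_sub_distrib]
  refine Finset.sum_congr rfl fun β hβ => Finset.sum_congr rfl fun γ hγ => ?_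
  rw [half_siteMatrix_form_add d (Finset.mem_filter.mp hβ).2 (Finset.mem_filter.mp hγ).2]
  module

lemma spinTot_dotProduct_self :
    spinTot N d ⬝ᵥ spinTot N d = ∑ β : Fin N, ∑ γ : Fin N, spin d β ⬝ᵥ spin d γ := by
  have h : spinTot N d = ∑ β : Fin N, spin d β := by
    funext i
    rw [Finset.sum_apply]
    rfl
  rw [h, sum_dotProduct]
  simp_rw [dotProduct_sum]

/-- With the pair `(β, γ)` fixed, the weight is summed over the central site. For `β ≠ γ` this gives
twice the pair weight minus `1/2`, and the `1/2` is restored by the total spin. For `β = γ` the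
Casimir value appears with `(N² - 1)/12 + 1/2 = (N² + 5)/12`. -/
lemma sum_three_site :
    ∑ α : Fin N, ∑ β : Fin N with β ≠ α, ∑ γ : Fin N with γ ≠ α,
        pairWeight α β γ • (spin d β ⬝ᵥ spin d γ)
      + (1 / 2 : ℂ) • (spinTot N d ⬝ᵥ spinTot N d)
      = (2 : ℂ) • ∑ α : Fin N, ∑ β : Fin N with β ≠ α,
          pairWeight α β β • (spin d α ⬝ᵥ spin d β)
        + ((spinS d : ℂ) * (spinS d + 1) * (N * ((N : ℂ) ^ 2 + 5) / 12)) • 1 := by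
  have h1 : ∑ α : Fin N, ∑ β : Fin N with β ≠ α, ∑ γ : Fin N with γ ≠ α,
        pairWeight α β γ • (spin d β ⬝ᵥ spin d γ)
      = ∑ β : Fin N, ∑ γ : Fin N, (∑ α : Fin N with β ≠ α ∧ γ ≠ α, pairWeight α β γ) •
        (spin d β ⬝ᵥ spin d γ) := by
    simp_rw [Finset.sum_smul, Finset.sum_filter]
    rw [Finset.sum_comm]
    refine Finset.sum_congr rfl fun β _ => ?_
    rw [Finset.sum_comm]
    refine Finset.sum_congr rfl fun α _ => ?_
    by_cases h : β ≠ α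
    · simp [h]
    · simp [h]
  have h2 : ∀ β γ : Fin N, (∑ α : Fin N with β ≠ α ∧ γ ≠ α, pairWeight α β γ) •
        (spin d β ⬝ᵥ spin d γ) + (1 / 2 : ℂ) • (spin d β ⬝ᵥ spin d γ)
      = (2 : ℂ) • (if γ ≠ β then pairWeight β γ γ • (spin d β ⬝ᵥ spin d γ) else 0)
        + if β = γ then
            ((spinS d : ℂ) * (spinS d + 1) * (((N : ℂ) ^ 2 + 5) / 12)) • (1 : Op N d)
          else 0 := by
    intro β γ
    by_cases h : β = γ
    · subst h
      have h3 := sum_one_sub_cotCoef_sq β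
      have h4 : ∑ α : Fin N with β ≠ α ∧ β ≠ α, pairWeight α β β = ((N : ℂ) ^ 2 - 1) / 12 := by
        rw [← h3]
        simp only [and_self, ne_comm (a := β)]
        rfl
      rw [h4, if_neg (by simp), if_pos rfl, smul_zero, zero_add, spin_casimir, smul_smul,
        smul_smul, ← add_smul]
      congr 1
      ring
    · have h3 := sum_pair_weight h
      have h4 : ∑ α : Fin N with β ≠ α ∧ γ ≠ α, pairWeight α β γ
          = 2 * pairWeight β γ γ - 1 / 2 := h3
      rw [h4, if_pos (Ne.symm h), if_neg h]
      module
  have h5 : ∑ β : Fin N, ∑ γ : Fin N, (if β = γ then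
        ((spinS d : ℂ) * (spinS d + 1) * (((N : ℂ) ^ 2 + 5) / 12)) • (1 : Op N d) else 0)
      = ((spinS d : ℂ) * (spinS d + 1) * (N * ((N : ℂ) ^ 2 + 5) / 12)) • 1 := by
    simp only [Finset.sum_ite_eq, Finset.mem_univ, if_true, Finset.sum_const, Finset.card_univ,
      Fintype.card_fin]
    rw [← Nat.cast_smul_eq_nsmul ℂ, smul_smul]
    congr 1
    ring
  have h6 : ∑ α : Fin N, ∑ β : Fin N with β ≠ α, pairWeight α β β • (spin d α ⬝ᵥ spin d β)
      = ∑ α : Fin N, ∑ β : Fin N,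
          if β ≠ α then pairWeight α β β • (spin d α ⬝ᵥ spin d β) else 0 := by
    simp_rw [Finset.sum_filter]
  rw [h1, spinTot_dotProduct_self, ← h5, h6]
  simp_rw [Finset.smul_sum, ← Finset.sum_add_distrib, h2]

/-- The complex weight is `pairWeight` plus a part antisymmetric in `β, γ`, which drops out against
the symmetrized product of the exchange operators. -/
lemma hamiltonian_eq :
    hamiltonian N d = (2 * (Real.pi : ℂ) ^ 2 / (N : ℂ) ^ 2) •
      ((∑ α : Fin N, ∑ β : Fin N with β ≠ α, pairWeight α β β • (spin d α ⬝ᵥ spin d β))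
        - (1 / (2 * ((spinS d : ℂ) + 1) * (2 * (spinS d : ℂ) + 3))) •
          ∑ α : Fin N, ∑ β : Fin N with β ≠ α, ∑ γ : Fin N with γ ≠ α, pairWeight α β γ •
            ((spin d α ⬝ᵥ spin d β) * (spin d α ⬝ᵥ spin d γ)
              + (spin d α ⬝ᵥ spin d γ) * (spin d α ⬝ᵥ spin d β))) := by
  rw [hamiltonian]
  congr 2
  · refine Finset.sum_congr rfl fun α _ => Finset.sum_congr rfl fun β hβ => ?_
    rw [dist_weight_eq_cotCoef (Finset.mem_filter.mp hβ).2, pairWeight]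
  · congr 1
    refine Finset.sum_congr rfl fun α _ => ?_
    have h : ∀ β ∈ Finset.univ.filter (fun β : Fin N => β ≠ α),
        ∀ γ ∈ Finset.univ.filter (fun γ : Fin N => γ ≠ α), ∀ X : Op N d,
        (1 / ((conj (site α) - conj (site β)) * (site α - site γ))) • X
          = pairWeight α β γ • X + ((cotCoef α γ - cotCoef α β) / 4) • X := by
      intro β hβ γ hγ X
      rw [weight_eq_cotCoef (Finset.mem_filter.mp hβ).2 (Finset.mem_filter.mp hγ).2,
        ← add_smul, pairWeight]
      congr 1
      ring
    rw [Finset.sum_congr rfl fun β hβ => Finset.sum_congr rfl fun γ hγ => h β hβ γ hγ _]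
    simp_rw [Finset.sum_add_distrib]
    rw [add_eq_left]
    set s := Finset.univ.filter (fun β : Fin N => β ≠ α)
    set X : Fin N → Fin N → Op N d := fun β γ =>
      (spin d α ⬝ᵥ spin d β) * (spin d α ⬝ᵥ spin d γ)
        + (spin d α ⬝ᵥ spin d γ) * (spin d α ⬝ᵥ spin d β) with hX
    change ∑ β ∈ s, ∑ γ ∈ s, ((cotCoef α γ - cotCoef α β) / 4) • X β γ = 0
    have hs : ∀ β γ, X β γ = X γ β := fun β γ => add_comm _ _
    have h3 : ∑ β ∈ s, ∑ γ ∈ s, (cotCoef α γ / 4) • X β γ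
        = ∑ β ∈ s, ∑ γ ∈ s, (cotCoef α β / 4) • X β γ := by
      rw [Finset.sum_comm]
      simp_rw [hs]
    simp_rw [sub_div, sub_smul, Finset.sum_sub_distrib]
    rw [h3, sub_self]

theorem factorization :
    (2 * (Real.pi : ℂ) ^ 2 / (N : ℂ) ^ 2) •
        ((1 / ((2 * (spinS d : ℂ) + 1) * (2 * (spinS d : ℂ) + 3))) •
            (∑ α : Fin N, (normSqOp (opD d α) + normSqOp (opB d α)))
          + (((spinS d : ℂ) + 1) / (2 * (2 * (spinS d : ℂ) + 3))) •
            (spinTot N d ⬝ᵥ spinTot N d))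
      = hamiltonian N d - (groundEnergy N d : ℂ) • 1 := by
  have hs0 : (0 : ℝ) ≤ spinS d := by
    rw [spinS]
    positivity
  have h1 := spinS_add_one_ne_zero d
  have h2 : 2 * (spinS d : ℂ) + 1 ≠ 0 := by
    have : 2 * spinS d + 1 ≠ 0 := by positivity
    exact_mod_cast this
  have h3 : 2 * (spinS d : ℂ) + 3 ≠ 0 := by
    have : 2 * spinS d + 3 ≠ 0 := by positivity
    exact_mod_cast this
  have h4 := sum_three_site (N := N) d
  rw [hamiltonian_eq, groundEnergy]
  simp_rw [normSqOp_opD_add_opB]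
  rw [← Finset.smul_sum, Finset.sum_sub_distrib, Finset.sum_add_distrib, ← Finset.smul_sum,
    ← Finset.smul_sum]
  push_cast
  set s := (spinS d : ℂ)
  set k := 2 * (Real.pi : ℂ) ^ 2 / (N : ℂ) ^ 2
  set W : Op N d := ∑ α : Fin N, ∑ β : Fin N with β ≠ α,
    pairWeight α β β • (spin d α ⬝ᵥ spin d β)
  set Y : Op N d := ∑ α : Fin N, ∑ β : Fin N with β ≠ α, ∑ γ : Fin N with γ ≠ α,
    pairWeight α β γ • (spin d β ⬝ᵥ spin d γ)
  set T := spinTot N d ⬝ᵥ spinTot N d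
  -- After this substitution `W` has coefficient `1 + 2 (s + 1) = 2s + 3`, which cancels the
  -- prefactor, and the two multiples of `T` cancel.
  have hY : Y = (2 : ℂ) • W + (s * (s + 1) * (N * ((N : ℂ) ^ 2 + 5) / 12)) • 1
      - (1 / 2 : ℂ) • T := eq_sub_of_add_eq h4
  rw [hY]
  match_scalars <;> field_simp <;> ring

end Factorization

/-! ### Spin operators as derivations on Schwinger-boson polynomials -/

section Bosons

variable {N : ℕ} {d : ℕ}

/-- The ring of polynomials in the creation operators. -/
abbrev BosonRing (N : ℕ) : Type := MvPolynomial (Fin N ⊕ Fin N) ℂ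

lemma bosonExponent_inl (n : Config N d) (α : Fin N) :
    bosonExponent n (Sum.inl α) = (n α : ℕ) := rfl

lemma bosonExponent_inr (n : Config N d) (α : Fin N) :
    bosonExponent n (Sum.inr α) = d - (n α : ℕ) := rfl

lemma bosonState_add (P Q : BosonRing N) :
    bosonState N d (P + Q) = bosonState N d P + bosonState N d Q := by
  funext n
  simp [bosonState, add_mul]

lemma bosonState_smul (c : ℂ) (P : BosonRing N) :
    bosonState N d (c • P) = c • bosonState N d P := by
  funext n
  simp [bosonState, mul_assoc]

/-- `bosonState` as a linear map. -/
noncomputable def bosonLin (N d : ℕ) : BosonRing N →ₗ[ℂ] Ket N d where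
  toFun := bosonState N d
  map_add' := bosonState_add
  map_smul' := bosonState_smul

/-- The normalization of the one-site state with `k` bosons of the first kind. -/
noncomputable def siteNorm (d k : ℕ) : ℝ := Real.sqrt ((k.factorial : ℝ) * ((d - k).factorial : ℝ))

lemma siteNorm_pos (d k : ℕ) : 0 < siteNorm d k := by
  rw [siteNorm]
  positivity

/-- With `siteNorm_pred`, this matches the square roots in the ladder operators with the integer
factors produced by differentiating monomials. -/
lemma siteNorm_succ {d k : ℕ} (hk : k < d) :
    Real.sqrt (((d : ℝ) - k) * ((k : ℝ) + 1)) * siteNorm d (k + 1) = ((k : ℝ) + 1) * siteNorm d k := by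
  have h1 : (k : ℝ) < d := by exact_mod_cast hk
  have h2 : (0 : ℝ) ≤ (d : ℝ) - k := by linarith
  obtain ⟨m, rfl⟩ : ∃ m, d = k + 1 + m := ⟨d - (k + 1), by omega⟩
  rw [siteNorm, siteNorm, ← Real.sqrt_mul (by positivity)]
  rw [Real.sqrt_eq_iff_mul_self_eq (by positivity) (by positivity)]
  rw [mul_mul_mul_comm ((k : ℝ) + 1), Real.mul_self_sqrt (by positivity)]
  have e1 : k + 1 + m - k = m + 1 := by omega
  have e2 : k + 1 + m - (k + 1) = m := by omega
  rw [e1, e2, Nat.factorial_succ, Nat.factorial_succ]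
  push_cast
  ring

lemma siteNorm_pred {d k : ℕ} (hk : k < d) :
    Real.sqrt (((d : ℝ) - k) * ((k : ℝ) + 1)) * siteNorm d k
      = ((d : ℝ) - k) * siteNorm d (k + 1) := by
  have h1 : (k : ℝ) < d := by exact_mod_cast hk
  have h2 : (0 : ℝ) ≤ (d : ℝ) - k := by linarith
  have h3 := siteNorm_succ hk
  have h4 : Real.sqrt (((d : ℝ) - k) * ((k : ℝ) + 1)) * Real.sqrt (((d : ℝ) - k) * ((k : ℝ) + 1))
      = ((d : ℝ) - k) * ((k : ℝ) + 1) := Real.mul_self_sqrt (by positivity)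
  have h5 : ((k : ℝ) + 1) ≠ 0 := by positivity
  apply mul_left_cancel₀ h5
  linear_combination -(Real.sqrt (((d : ℝ) - k) * ((k : ℝ) + 1))) * h3 + siteNorm d (k + 1) * h4

lemma bosonState_apply (P : BosonRing N) (n : Config N d) (α : Fin N) :
    bosonState N d P n = P.coeff (bosonExponent n) *
      ((siteNorm d (n α) : ℂ) * ∏ β ∈ Finset.univ.erase α, (siteNorm d (n β) : ℂ)) := by
  rw [Finset.mul_prod_erase _ (fun β => (siteNorm d (n β) : ℂ)) (Finset.mem_univ α)]
  rfl

lemma bosonState_update (P : BosonRing N) (n : Config N d) (α : Fin N) (j : Fin (d + 1)) :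
    bosonState N d P (Function.update n α j)
      = P.coeff (bosonExponent (Function.update n α j)) *
        ((siteNorm d j : ℂ) * ∏ β ∈ Finset.univ.erase α, (siteNorm d (n β) : ℂ)) := by
  rw [bosonState_apply P _ α, Function.update_self]
  congr 2
  refine Finset.prod_congr rfl fun β hβ => ?_
  rw [Function.update_of_ne (Finset.ne_of_mem_erase hβ)]

/-- The creation operator `a†_α`. -/
noncomputable def bosonA (α : Fin N) : BosonRing N := MvPolynomial.X (Sum.inl α)

/-- The creation operator `b†_α`. -/
noncomputable def bosonB (α : Fin N) : BosonRing N := MvPolynomial.X (Sum.inr α)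

/-- The derivative with respect to `a†_α`. -/
noncomputable def derA (α : Fin N) : Derivation ℂ (BosonRing N) (BosonRing N) :=
  MvPolynomial.pderiv (Sum.inl α)

/-- The derivative with respect to `b†_α`. -/
noncomputable def derB (α : Fin N) : Derivation ℂ (BosonRing N) (BosonRing N) :=
  MvPolynomial.pderiv (Sum.inr α)

lemma update_exponent_pred (n : Config N d) (α : Fin N) (j : Fin (d + 1))
    (h : (n α : ℕ) = j + 1) :
    bosonExponent n - Finsupp.single (Sum.inl α) 1 + Finsupp.single (Sum.inr α) 1
      = bosonExponent (Function.update n α j) := by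
  have := (n α).isLt
  ext x
  rcases x with β | β
  · rcases eq_or_ne β α with rfl | hβ
    · simp [bosonExponent_inl, h]
    · simp [bosonExponent_inl, hβ]
  · rcases eq_or_ne β α with rfl | hβ
    · simp [bosonExponent_inr, h]
      omega
    · simp [bosonExponent_inr, hβ]

lemma update_exponent_succ (n : Config N d) (α : Fin N) (j : Fin (d + 1))
    (h : (j : ℕ) = n α + 1) :
    bosonExponent n - Finsupp.single (Sum.inr α) 1 + Finsupp.single (Sum.inl α) 1
      = bosonExponent (Function.update n α j) := by
  have := j.isLt
  ext x
  rcases x with β | β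
  · rcases eq_or_ne β α with rfl | hβ
    · simp [bosonExponent_inl, h]
    · simp [bosonExponent_inl, hβ]
  · rcases eq_or_ne β α with rfl | hβ
    · simp [bosonExponent_inr, h]
      omega
    · simp [bosonExponent_inr, hβ]

/-- This holds for every `P`: `a ∂_b` preserves the boson number of a site, so coefficients outside
the spin-`S` sector, which `bosonState` ignores, never enter. -/
lemma raising_mulVec_bosonState (α : Fin N) (P : BosonRing N) :
    onSite α (raising d) *ᵥ bosonState N d P = bosonState N d (bosonA α * derB α P) := by
  classical
  funext n
  have hn := (n α).isLt
  rw [onSite_mulVec, bosonState_apply _ n α, bosonA, derB, MvPolynomial.coeff_X_mul']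
  simp only [raising, Matrix.of_apply, Finsupp.mem_support_iff, bosonExponent_inl]
  by_cases h0 : (n α : ℕ) = 0
  · rw [if_neg (by simp [h0]), zero_mul]
    refine Finset.sum_eq_zero fun j _ => ?_
    rw [if_neg (by omega), zero_mul]
  · rw [if_pos (by simpa using h0), Finset.sum_eq_single (⟨(n α : ℕ) - 1, by omega⟩ : Fin (d + 1))]
    · set j : Fin (d + 1) := ⟨(n α : ℕ) - 1, by omega⟩
      have hj : (n α : ℕ) = j + 1 := by simp only [j]; omega
      rw [if_pos hj, bosonState_update, MvPolynomial.coeff_pderiv, update_exponent_pred n α j hj]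
      have e := congrArg (fun x : ℝ => (x : ℂ)) (siteNorm_pred (d := d) (k := j) (by omega))
      simp only [Complex.ofReal_mul, Complex.ofReal_sub, Complex.ofReal_natCast] at e
      have e2 : (((bosonExponent n - Finsupp.single (Sum.inl α) 1 : (Fin N ⊕ Fin N) →₀ ℕ)
          (Sum.inr α) : ℕ) : ℂ) + 1
          = (d : ℂ) - (j : ℕ) := by
        simp [bosonExponent_inr, hj]
        rw [Nat.cast_sub (by omega)]
        push_cast
        ring
      rw [e2, hj]
      linear_combination (MvPolynomial.coeff (bosonExponent (Function.update n α j)) P *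
        ∏ β ∈ Finset.univ.erase α, (siteNorm d (n β) : ℂ)) * e
    · intro j _ hj
      rw [if_neg (fun e => hj (Fin.ext (by simp only []; omega))), zero_mul]
    · simp

lemma lowering_mulVec_bosonState (α : Fin N) (P : BosonRing N) :
    onSite α (lowering d) *ᵥ bosonState N d P = bosonState N d (bosonB α * derA α P) := by
  classical
  funext n
  have hn := (n α).isLt
  rw [onSite_mulVec, bosonState_apply _ n α, bosonB, derA, MvPolynomial.coeff_X_mul']
  simp only [lowering, raising, Matrix.conjTranspose_apply, Matrix.of_apply,
    Finsupp.mem_support_iff, bosonExponent_inr]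
  by_cases h0 : (n α : ℕ) = d
  · rw [if_neg (by simp [h0]), zero_mul]
    refine Finset.sum_eq_zero fun j _ => ?_
    have := j.isLt
    rw [if_neg (by omega), star_zero, zero_mul]
  · rw [if_pos (by omega), Finset.sum_eq_single (⟨(n α : ℕ) + 1, by omega⟩ : Fin (d + 1))]
    · set j : Fin (d + 1) := ⟨(n α : ℕ) + 1, by omega⟩
      have hj : (j : ℕ) = n α + 1 := rfl
      rw [if_pos hj, bosonState_update, MvPolynomial.coeff_pderiv, update_exponent_succ n α j hj]
      have e := congrArg (fun x : ℝ => (x : ℂ)) (siteNorm_succ (d := d) (k := n α) (by omega))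
      simp only [Complex.ofReal_mul, Complex.ofReal_add, Complex.ofReal_natCast,
        Complex.ofReal_one] at e
      have e2 : (((bosonExponent n - Finsupp.single (Sum.inr α) 1 : (Fin N ⊕ Fin N) →₀ ℕ)
          (Sum.inl α) : ℕ) : ℂ) + 1
          = ((n α : ℕ) : ℂ) + 1 := by
        simp [bosonExponent_inl]
      rw [e2, hj, RCLike.star_def, Complex.conj_ofReal]
      linear_combination (MvPolynomial.coeff (bosonExponent (Function.update n α j)) P *
        ∏ β ∈ Finset.univ.erase α, (siteNorm d (n β) : ℂ)) * e
    · intro j _ hj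
      rw [if_neg (fun e => hj (Fin.ext (by simp only []; omega))), star_zero, zero_mul]
    · simp

lemma coeff_X_mul_pderiv (i : Fin N ⊕ Fin N) (P : BosonRing N) (m : (Fin N ⊕ Fin N) →₀ ℕ) :
    (MvPolynomial.X i * MvPolynomial.pderiv i P).coeff m = m i * P.coeff m := by
  classical
  rw [MvPolynomial.coeff_X_mul']
  split_ifs with h
  · have h1 : 1 ≤ m i := Nat.one_le_iff_ne_zero.mpr (Finsupp.mem_support_iff.mp h)
    have h2 : m - Finsupp.single i 1 + Finsupp.single i 1 = m :=
      tsub_add_cancel_of_le (Finsupp.single_le_iff.mpr h1)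
    rw [MvPolynomial.coeff_pderiv, h2, Finsupp.tsub_apply, Finsupp.single_eq_same,
      Nat.cast_sub h1]
    push_cast
    ring
  · rw [Finsupp.notMem_support_iff.mp h, Nat.cast_zero, zero_mul]

lemma spinOne_two_mulVec_bosonState (α : Fin N) (P : BosonRing N) :
    onSite α (spinOne d 2) *ᵥ bosonState N d P
      = bosonState N d ((1 / 2 : ℂ) • (bosonA α * derA α P - bosonB α * derB α P)) := by
  funext n
  have hn := (n α).isLt
  rw [onSite_mulVec, bosonState_smul, spinOne_two]
  simp only [Matrix.diagonal_apply, ite_mul, zero_mul]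
  rw [Finset.sum_ite_eq, if_pos (Finset.mem_univ _), Function.update_eq_self, Pi.smul_apply,
    bosonState, bosonState, MvPolynomial.coeff_sub, bosonA, bosonB, derA, derB,
    coeff_X_mul_pderiv, coeff_X_mul_pderiv, bosonExponent_inl, bosonExponent_inr,
    Nat.cast_sub (by omega), smul_eq_mul]
  ring

/-- The spin operators of a site as derivations of the ring of creation operators. -/
noncomputable def spinDer (α : Fin N) : Fin 3 → Derivation ℂ (BosonRing N) (BosonRing N) :=
  ![(1 / 2 : ℂ) • (bosonA α • derB α + bosonB α • derA α),
    (-(Complex.I / 2) : ℂ) • (bosonA α • derB α - bosonB α • derA α),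
    (1 / 2 : ℂ) • (bosonA α • derA α - bosonB α • derB α)]

lemma spin_mulVec_bosonLin (α : Fin N) (i : Fin 3) (P : BosonRing N) :
    spin d α i *ᵥ bosonLin N d P = bosonLin N d (spinDer α i P) := by
  fin_cases i
  · change onSite α (spinOne d 0) *ᵥ bosonState N d P
      = bosonLin N d ((1 / 2 : ℂ) • (bosonA α * derB α P + bosonB α * derA α P))
    rw [spinOne_zero, onSite_smul, onSite_add, Matrix.smul_mulVec, Matrix.add_mulVec,
      raising_mulVec_bosonState, lowering_mulVec_bosonState, map_smul, map_add]
    rfl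
  · change onSite α (spinOne d 1) *ᵥ bosonState N d P
      = bosonLin N d ((-(Complex.I / 2) : ℂ) • (bosonA α * derB α P - bosonB α * derA α P))
    rw [spinOne_one, one_div_two_I, onSite_smul, onSite_sub, Matrix.smul_mulVec,
      Matrix.sub_mulVec, raising_mulVec_bosonState, lowering_mulVec_bosonState, map_smul, map_sub]
    rfl
  · exact spinOne_two_mulVec_bosonState α P

end Bosons

/-! ### Vanishing sums of the Haldane-Shastry wave function -/

section Wave

variable {N : ℕ}

lemma hsWave_insert {T : Finset (Fin N)} {β : Fin N} (h : β ∉ T) :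
    hsWave (insert β T) = hsWave T * (site β * ∏ γ ∈ T, (site β - site γ) ^ 2) := by
  have h1 : ∀ α ∈ T, ∏ γ ∈ insert β T with α < γ, (site α - site γ) ^ 2
      = (if α < β then (site α - site β) ^ 2 else 1)
        * ∏ γ ∈ T with α < γ, (site α - site γ) ^ 2 := by
    intro α _
    rw [Finset.prod_filter, Finset.prod_insert h, Finset.prod_filter]
  have h2 : ∏ γ ∈ T, (site β - site γ) ^ 2
      = (∏ γ ∈ T, if β < γ then (site β - site γ) ^ 2 else 1)
        * ∏ γ ∈ T, if γ < β then (site γ - site β) ^ 2 else 1 := by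
    rw [← Finset.prod_mul_distrib]
    refine Finset.prod_congr rfl fun γ hγ => ?_
    rcases lt_trichotomy β γ with h3 | h3 | h3
    · rw [if_pos h3, if_neg h3.asymm, mul_one]
    · exact absurd (h3 ▸ hγ) h
    · rw [if_neg h3.asymm, if_pos h3, one_mul]
      ring
  rw [hsWave, hsWave, Finset.prod_insert h, Finset.prod_insert h, Finset.prod_congr rfl h1,
    Finset.prod_mul_distrib, Finset.prod_filter, Finset.prod_insert h, if_neg (lt_irrefl β), h2]
  ring

lemma hsWave_ne_zero (T : Finset (Fin N)) : hsWave T ≠ 0 := by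
  refine mul_ne_zero (Finset.prod_ne_zero_iff.mpr fun α _ => Finset.prod_ne_zero_iff.mpr
    fun β hβ => pow_ne_zero 2 (site_sub_ne_zero (Finset.mem_filter.mp hβ).2.ne)) ?_
  exact Finset.prod_ne_zero_iff.mpr fun α _ => site_ne_zero α

lemma natDegree_prod_sq_le (T : Finset (Fin N)) :
    (∏ γ ∈ T, (Polynomial.X - Polynomial.C (site γ)) ^ 2).natDegree ≤ 2 * T.card := by
  refine (Polynomial.natDegree_prod_le _ _).trans ?_
  rw [mul_comm, ← smul_eq_mul, ← Finset.sum_const]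
  exact Finset.sum_le_sum fun γ _ =>
    (Polynomial.natDegree_pow_le).trans (by rw [Polynomial.natDegree_X_sub_C])

/-- In the coordinate `η_β` the wave function is a polynomial that vanishes on `T`, so the sum
extends to all sites. It has no constant term and degree at most `2 |T| + 1 < N`. -/
lemma sum_compl_hsWave_insert {T : Finset (Fin N)} (hT : 2 * T.card + 1 < N) :
    ∑ β ∈ Tᶜ, hsWave (insert β T) = 0 := by
  have h1 : ∀ β ∈ Tᶜ, hsWave (insert β T) = hsWave T *
      (Polynomial.X * ∏ γ ∈ T, (Polynomial.X - Polynomial.C (site γ)) ^ 2 :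
        Polynomial ℂ).eval (site β) := by
    intro β hβ
    rw [hsWave_insert (Finset.mem_compl.mp hβ), Polynomial.eval_mul, Polynomial.eval_X,
      Polynomial.eval_prod]
    simp
  rw [Finset.sum_congr rfl h1, ← Finset.mul_sum, Finset.sum_subset (Finset.subset_univ _),
    sum_eval_site, mul_zero]
  · simp
  · refine lt_of_le_of_lt (Polynomial.natDegree_mul_le) ?_
    have := natDegree_prod_sq_le T
    rw [Polynomial.natDegree_X]
    omega
  · intro β _ hβ
    have hβ' : β ∈ T := by simpa using hβ
    rw [Polynomial.eval_mul, Polynomial.eval_prod, Finset.prod_eq_zero hβ' (by simp), mul_zero]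

/-- As `α ∈ T`, the factor `(η_β - η_α)²` absorbs the pole of `θ_{αβ}` and still leaves a zero at `β
= α`. The degree bound stays `2 |T| + 1`. -/
lemma sum_compl_cotCoef_hsWave_insert {T : Finset (Fin N)} {α : Fin N} (hα : α ∈ T)
    (hT : 2 * T.card + 1 < N) :
    ∑ β ∈ Tᶜ, cotCoef α β * hsWave (insert β T) = 0 := by
  set p : Polynomial ℂ := Polynomial.X * ((Polynomial.X + Polynomial.C (site α)) *
    (Polynomial.C (site α) - Polynomial.X)) *
      ∏ γ ∈ T.erase α, (Polynomial.X - Polynomial.C (site γ)) ^ 2 with hp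
  have h1 : ∀ β ∈ Tᶜ, cotCoef α β * hsWave (insert β T) = hsWave T * p.eval (site β) := by
    intro β hβ
    have hβ' := Finset.mem_compl.mp hβ
    have hne : α ≠ β := fun e => hβ' (e ▸ hα)
    have h2 := site_sub_ne_zero hne
    rw [hsWave_insert hβ', ← Finset.mul_prod_erase T _ hα, hp]
    simp only [Polynomial.eval_mul, Polynomial.eval_X, Polynomial.eval_prod, Polynomial.eval_add,
      Polynomial.eval_sub, Polynomial.eval_C, Polynomial.eval_pow]
    rw [cotCoef]
    field_simp
    ring
  rw [Finset.sum_congr rfl h1, ← Finset.mul_sum, Finset.sum_subset (Finset.subset_univ _),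
    sum_eval_site, mul_zero]
  · simp [hp]
  · have h3 := natDegree_prod_sq_le (T.erase α)
    rw [Finset.card_erase_of_mem hα] at h3
    have h4 : 0 < T.card := Finset.card_pos.mpr ⟨α, hα⟩
    have h5 : (Polynomial.X * ((Polynomial.X + Polynomial.C (site α)) *
        (Polynomial.C (site α) - Polynomial.X)) : Polynomial ℂ).natDegree ≤ 3 := by
      compute_degree
    have h6 := Polynomial.natDegree_mul_le (p := (Polynomial.X * ((Polynomial.X +
      Polynomial.C (site α)) * (Polynomial.C (site α) - Polynomial.X)) : Polynomial ℂ))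
      (q := ∏ γ ∈ T.erase α, (Polynomial.X - Polynomial.C (site γ)) ^ 2)
    rw [hp]
    omega
  · intro β _ hβ
    have hβ' : β ∈ T := by simpa using hβ
    rw [hp, Polynomial.eval_mul]
    rcases eq_or_ne β α with rfl | hne
    · simp
    · rw [Polynomial.eval_prod, Finset.prod_eq_zero (Finset.mem_erase.mpr ⟨hne, hβ'⟩) (by simp),
        mul_zero]

end Wave

/-! ### The derivations on the polynomial `Ψ^HS` -/

section Monomials

variable {N : ℕ}

lemma derA_bosonA (α β : Fin N) : derA α (bosonA β) = if β = α then 1 else 0 := by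
  rw [derA, bosonA]
  split_ifs with h
  · rw [h, MvPolynomial.pderiv_X_self]
  · exact MvPolynomial.pderiv_X_of_ne fun e => h (Sum.inl.inj e)

lemma derB_bosonB (α β : Fin N) : derB α (bosonB β) = if β = α then 1 else 0 := by
  rw [derB, bosonB]
  split_ifs with h
  · rw [h, MvPolynomial.pderiv_X_self]
  · exact MvPolynomial.pderiv_X_of_ne fun e => h (Sum.inr.inj e)

lemma derA_bosonB (α β : Fin N) : derA α (bosonB β) = 0 :=
  MvPolynomial.pderiv_X_of_ne (by simp)

lemma derB_bosonA (α β : Fin N) : derB α (bosonA β) = 0 :=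
  MvPolynomial.pderiv_X_of_ne (by simp)

lemma derivation_prod_eq_zero {ι : Type*} (D : Derivation ℂ (BosonRing N) (BosonRing N))
    (s : Finset ι) (f : ι → BosonRing N) (h : ∀ i ∈ s, D (f i) = 0) : D (∏ i ∈ s, f i) = 0 := by
  classical
  induction s using Finset.induction_on with
  | empty => simp
  | insert i s hi ih =>
    rw [Finset.prod_insert hi, D.leibniz, h i (Finset.mem_insert_self i s),
      ih fun j hj => h j (Finset.mem_insert_of_mem hj), smul_zero, smul_zero, add_zero]

/-- The factor of `bosonMonomial` at one site. -/
noncomputable def bosonFactor (T : Finset (Fin N)) (α : Fin N) : BosonRing N :=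
  if α ∈ T then bosonA α else bosonB α

/-- The monomial with `a` bosons on `T` and `b` bosons elsewhere. -/
noncomputable def bosonMonomial (T : Finset (Fin N)) : BosonRing N := ∏ α, bosonFactor T α

lemma hsPoly_eq : hsPoly N = ∑ T ∈ (Finset.univ : Finset (Fin N)).powersetCard (N / 2),
    hsWave T • bosonMonomial T := by
  rw [hsPoly]
  refine Finset.sum_congr rfl fun T _ => ?_
  rw [MvPolynomial.smul_eq_C_mul, bosonMonomial]
  simp only [bosonFactor]
  rw [Finset.prod_ite]
  congr 2
  · refine Finset.prod_congr ?_ fun _ _ => rfl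
    ext; simp
  · refine Finset.prod_congr ?_ fun _ _ => rfl
    ext; simp

lemma bosonMonomial_eq_mul (T : Finset (Fin N)) (α : Fin N) :
    bosonMonomial T = bosonFactor T α * ∏ β ∈ Finset.univ.erase α, bosonFactor T β :=
  (Finset.mul_prod_erase _ _ (Finset.mem_univ α)).symm

lemma derA_bosonMonomial (T : Finset (Fin N)) (α : Fin N) :
    derA α (bosonMonomial T)
      = if α ∈ T then ∏ β ∈ Finset.univ.erase α, bosonFactor T β else 0 := by
  rw [bosonMonomial_eq_mul T α, Derivation.leibniz, derivation_prod_eq_zero, bosonFactor]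
  · split_ifs
    · rw [derA_bosonA, if_pos rfl, smul_zero, zero_add, smul_eq_mul, mul_one]
    · rw [derA_bosonB, smul_zero, smul_zero, add_zero]
  · intro β hβ
    rw [bosonFactor]
    split_ifs
    · rw [derA_bosonA, if_neg (Finset.ne_of_mem_erase hβ)]
    · rw [derA_bosonB]

lemma derB_bosonMonomial (T : Finset (Fin N)) (α : Fin N) :
    derB α (bosonMonomial T)
      = if α ∈ T then 0 else ∏ β ∈ Finset.univ.erase α, bosonFactor T β := by
  rw [bosonMonomial_eq_mul T α, Derivation.leibniz, derivation_prod_eq_zero, bosonFactor]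
  · split_ifs
    · rw [derB_bosonA, smul_zero, smul_zero, add_zero]
    · rw [derB_bosonB, if_pos rfl, smul_zero, zero_add, smul_eq_mul, mul_one]
  · intro β hβ
    rw [bosonFactor]
    split_ifs
    · rw [derB_bosonA]
    · rw [derB_bosonB, if_neg (Finset.ne_of_mem_erase hβ)]

lemma bosonB_mul_derA_bosonMonomial (T : Finset (Fin N)) (α : Fin N) :
    bosonB α * derA α (bosonMonomial T) = if α ∈ T then bosonMonomial (T.erase α) else 0 := by
  rw [derA_bosonMonomial, mul_ite, mul_zero]
  congr 1
  rw [bosonMonomial_eq_mul _ α, bosonFactor, if_neg (Finset.notMem_erase α T)]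
  congr 1
  refine Finset.prod_congr rfl fun β hβ => ?_
  have := Finset.ne_of_mem_erase hβ
  simp [bosonFactor, this]

lemma bosonA_mul_derA_bosonMonomial (T : Finset (Fin N)) (α : Fin N) :
    bosonA α * derA α (bosonMonomial T) = if α ∈ T then bosonMonomial T else 0 := by
  rw [derA_bosonMonomial, mul_ite, mul_zero]
  split_ifs with h
  · rw [bosonMonomial_eq_mul _ α, bosonFactor, if_pos h]
  · rfl

lemma bosonB_mul_derB_bosonMonomial (T : Finset (Fin N)) (α : Fin N) :
    bosonB α * derB α (bosonMonomial T) = if α ∈ T then 0 else bosonMonomial T := by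
  rw [derB_bosonMonomial, mul_ite, mul_zero]
  split_ifs with h
  · rfl
  · rw [bosonMonomial_eq_mul _ α, bosonFactor, if_neg h]

lemma bosonB_dvd_bosonMonomial {T : Finset (Fin N)} {α : Fin N} (h : α ∉ T) :
    bosonB α ∣ bosonMonomial T := by
  rw [bosonMonomial_eq_mul _ α, bosonFactor, if_neg h]
  exact dvd_mul_right _ _

/-- The derivation that counts the bosons of a site. -/
noncomputable def eulerDer (α : Fin N) : Derivation ℂ (BosonRing N) (BosonRing N) :=
  bosonA α • derA α + bosonB α • derB α

lemma eulerDer_apply (α : Fin N) (P : BosonRing N) :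
    eulerDer α P = bosonA α * derA α P + bosonB α * derB α P := rfl

lemma eulerDer_hsPoly (α : Fin N) : eulerDer α (hsPoly N) = hsPoly N := by
  rw [hsPoly_eq, map_sum]
  refine Finset.sum_congr rfl fun T _ => ?_
  rw [Derivation.map_smul, eulerDer_apply, bosonA_mul_derA_bosonMonomial,
    bosonB_mul_derB_bosonMonomial]
  split_ifs <;> simp

lemma derivation_pow (D : Derivation ℂ (BosonRing N) (BosonRing N)) (P : BosonRing N) (d : ℕ) :
    D (P ^ d) = d * P ^ (d - 1) * D P := by
  rw [D.leibniz_pow, nsmul_eq_mul, smul_eq_mul, mul_assoc]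

lemma eulerDer_hsPoly_pow (α : Fin N) (d : ℕ) :
    eulerDer α (hsPoly N ^ d) = (d : ℂ) • hsPoly N ^ d := by
  rw [derivation_pow, eulerDer_hsPoly, Nat.cast_smul_eq_nsmul, nsmul_eq_mul]
  rcases d with _ | d
  · simp
  · rw [Nat.add_sub_cancel, mul_assoc, ← pow_succ]

/-- Reindexing by `(T, β) ↦ (T \ {β}, β)` collects, for each smaller set, all ways of having arrived
there by lowering one site. -/
lemma sum_lowering_hsPoly (hN : 2 ≤ N) (c : Fin N → ℂ) :
    ∑ β, c β • (bosonB β * derA β (hsPoly N))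
      = ∑ T ∈ (Finset.univ : Finset (Fin N)).powersetCard (N / 2 - 1),
        (∑ β ∈ Tᶜ, c β * hsWave (insert β T)) • bosonMonomial T := by
  have h1 : ∑ β, c β • (bosonB β * derA β (hsPoly N))
      = ∑ T ∈ (Finset.univ : Finset (Fin N)).powersetCard (N / 2), ∑ β ∈ T,
        (c β * hsWave T) • bosonMonomial (T.erase β) := by
    rw [hsPoly_eq]
    simp_rw [map_sum, Derivation.map_smul, Finset.mul_sum, mul_smul_comm,
      bosonB_mul_derA_bosonMonomial, Finset.smul_sum, smul_smul]
    rw [Finset.sum_comm]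
    refine Finset.sum_congr rfl fun T _ => ?_
    simp_rw [smul_ite, smul_zero]
    rw [Finset.sum_ite_mem, Finset.univ_inter]
  rw [h1]
  simp_rw [Finset.sum_smul]
  rw [Finset.sum_sigma', Finset.sum_sigma']
  refine Finset.sum_bij' (fun x _ => ⟨x.1.erase x.2, x.2⟩) (fun x _ => ⟨insert x.2 x.1, x.2⟩)
    ?_ ?_ ?_ ?_ ?_
  · rintro ⟨T, β⟩ hx
    simp only [Finset.mem_sigma, Finset.mem_powersetCard_univ] at hx ⊢
    refine ⟨?_, by simp⟩
    rw [Finset.card_erase_of_mem hx.2, hx.1]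
  · rintro ⟨T, β⟩ hx
    simp only [Finset.mem_sigma, Finset.mem_powersetCard_univ, Finset.mem_compl] at hx ⊢
    refine ⟨?_, by simp⟩
    rw [Finset.card_insert_of_notMem hx.2, hx.1]
    -- Here `2 ≤ N` is needed for `N / 2 - 1 + 1 = N / 2` under truncated subtraction.
    omega
  · rintro ⟨T, β⟩ hx
    simp only [Finset.mem_sigma] at hx
    simp [Finset.insert_erase hx.2]
  · rintro ⟨T, β⟩ hx
    simp only [Finset.mem_sigma, Finset.mem_compl] at hx
    simp [Finset.erase_insert hx.2]
  · rintro ⟨T, β⟩ hx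
    simp only [Finset.mem_sigma] at hx
    simp only [Finset.insert_erase hx.2]

lemma two_mul_card_add_one_lt (hN : 2 ≤ N) {T : Finset (Fin N)} (hT : T.card = N / 2 - 1) :
    2 * T.card + 1 < N := by omega

lemma lowering_hsPoly (hN : 2 ≤ N) : ∑ β, bosonB β * derA β (hsPoly N) = 0 := by
  have h := sum_lowering_hsPoly hN (fun _ => 1)
  simp only [one_smul, one_mul] at h
  rw [h]
  refine Finset.sum_eq_zero fun T hT => ?_
  rw [sum_compl_hsWave_insert (two_mul_card_add_one_lt hN (Finset.mem_powersetCard_univ.mp hT)),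
    zero_smul]

/-- A monomial without `b_α` has `α ∈ T`, and its coefficient is the vanishing cotangent sum. -/
lemma bosonB_dvd_sum_cotCoef_lowering_hsPoly (hN : 2 ≤ N) (α : Fin N) :
    bosonB α ∣ ∑ β, cotCoef α β • (bosonB β * derA β (hsPoly N)) := by
  rw [sum_lowering_hsPoly hN]
  refine Finset.dvd_sum fun T hT => ?_
  by_cases hα : α ∈ T
  · rw [sum_compl_cotCoef_hsWave_insert hα
      (two_mul_card_add_one_lt hN (Finset.mem_powersetCard_univ.mp hT)), zero_smul]
    exact dvd_zero _
  · rw [MvPolynomial.smul_eq_C_mul]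
    exact (bosonB_dvd_bosonMonomial hα).mul_left _

lemma sum_spinZ_hsPoly (hN : Even N) :
    ∑ β, (bosonA β * derA β (hsPoly N) - bosonB β * derB β (hsPoly N)) = 0 := by
  rw [hsPoly_eq]
  simp_rw [map_sum, Derivation.map_smul, Finset.mul_sum, mul_smul_comm,
    bosonA_mul_derA_bosonMonomial, bosonB_mul_derB_bosonMonomial, ← Finset.sum_sub_distrib,
    ← smul_sub]
  rw [Finset.sum_comm]
  refine Finset.sum_eq_zero fun T hT => ?_
  rw [← Finset.smul_sum, Finset.sum_sub_distrib]
  have h1 : ∑ β, (if β ∈ T then bosonMonomial T else 0) = T.card • bosonMonomial T := by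
    rw [Finset.sum_ite_mem, Finset.univ_inter, Finset.sum_const]
  have h2 : ∑ β, (if β ∈ T then 0 else bosonMonomial T) = Tᶜ.card • bosonMonomial T := by
    rw [← Finset.sum_const]
    simp_rw [← ite_not (p := _ ∈ T), ← Finset.mem_compl]
    rw [Finset.sum_ite_mem, Finset.univ_inter]
  have h3 := Finset.mem_powersetCard_univ.mp hT
  -- Evenness of `N` is essential: for odd `N` the floor `N / 2` leaves the two numbers unequal.
  have h4 : Tᶜ.card = T.card := by
    rw [Finset.card_compl, Fintype.card_fin, h3]
    obtain ⟨m, rfl⟩ := hN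
    omega
  rw [h1, h2, h4, sub_self, smul_zero]

end Monomials

/-! ### The singlet property and the exchange derivation -/

section Singlet

variable {N : ℕ}

/-- Each monomial of `P` has exactly `d` bosons on every site, hence is read off by `bosonState`
with a nonzero factor. This transfers identities between states and polynomials. -/
lemma eq_zero_of_bosonLin_eq_zero {d : ℕ} {P : BosonRing N}
    (hE : ∀ α, eulerDer α P = (d : ℂ) • P) (h : bosonLin N d P = 0) : P = 0 := by
  refine MvPolynomial.ext _ _ fun m => ?_
  rw [MvPolynomial.coeff_zero]
  by_contra hm
  have h1 : ∀ α, m (Sum.inl α) + m (Sum.inr α) = d := by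
    intro α
    have h2 := congrArg (MvPolynomial.coeff m) (hE α)
    rw [eulerDer_apply, MvPolynomial.coeff_add, bosonA, bosonB, derA, derB, coeff_X_mul_pderiv,
      coeff_X_mul_pderiv, MvPolynomial.coeff_smul, smul_eq_mul, ← add_mul] at h2
    exact_mod_cast mul_right_cancel₀ hm h2
  set n : Config N d := fun α => ⟨m (Sum.inl α), by have := h1 α; omega⟩ with hn
  have h3 : bosonExponent n = m := by
    ext x
    rcases x with α | α
    · rfl
    · rw [bosonExponent_inr, hn]
      have := h1 α
      simp only []
      omega
  have h4 := congrFun h n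
  change P.coeff (bosonExponent n) * ∏ α, (siteNorm d (n α) : ℂ) = 0 at h4
  rw [h3] at h4
  refine (mul_ne_zero hm (Finset.prod_ne_zero_iff.mpr fun α _ => ?_)) h4
  exact_mod_cast (siteNorm_pos d (n α)).ne'

lemma bosonMonomial_eq_monomial (T : Finset (Fin N)) :
    bosonMonomial T = MvPolynomial.monomial
      (∑ α, Finsupp.single (if α ∈ T then Sum.inl α else Sum.inr α) 1) (1 : ℂ) := by
  rw [bosonMonomial, MvPolynomial.monomial_sum_one]
  refine Finset.prod_congr rfl fun α _ => ?_
  rw [bosonFactor]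
  split_ifs <;> rfl

/-- Distinct sets `T` give distinct monomials and the amplitudes are nonzero, so nothing cancels.
The polynomial ring being a domain, all powers are nonzero too. -/
lemma hsPoly_ne_zero : hsPoly N ≠ 0 := by
  classical
  obtain ⟨T, -, hT⟩ := Finset.exists_subset_card_eq
    (show N / 2 ≤ (Finset.univ : Finset (Fin N)).card by
      rw [Finset.card_univ, Fintype.card_fin]; exact Nat.div_le_self _ _)
  set e : Finset (Fin N) → (Fin N ⊕ Fin N) →₀ ℕ := fun T =>
    ∑ α, Finsupp.single (if α ∈ T then Sum.inl α else Sum.inr α) 1 with he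
  have hinj : Function.Injective e := by
    intro T T' h
    ext β
    have h1 : ∀ T : Finset (Fin N), e T (Sum.inl β) = if β ∈ T then 1 else 0 := by
      intro T
      rw [he, Finsupp.finsetSum_apply, Finset.sum_eq_single β]
      · split_ifs <;> simp
      · intro γ _ hγ
        split_ifs <;> simp [hγ]
      · simp
    have h2 := h1 T
    rw [h, h1 T'] at h2
    by_cases h3 : β ∈ T <;> by_cases h4 : β ∈ T' <;> simp_all
  intro h
  have h5 := congrArg (MvPolynomial.coeff (e T)) h
  rw [hsPoly_eq, MvPolynomial.coeff_sum, MvPolynomial.coeff_zero, Finset.sum_eq_single T] at h5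
  · rw [MvPolynomial.coeff_smul, bosonMonomial_eq_monomial, MvPolynomial.coeff_monomial,
      if_pos rfl, smul_eq_mul, mul_one] at h5
    exact hsWave_ne_zero T h5
  · intro T' _ hT'
    rw [MvPolynomial.coeff_smul, bosonMonomial_eq_monomial, MvPolynomial.coeff_monomial,
      if_neg fun h' => hT' (hinj h'), smul_zero]
  · exact fun h' => absurd (Finset.mem_powersetCard_univ.mpr hT) h'

lemma psi0_eq (d : ℕ) : psi0 N d = bosonLin N d (hsPoly N ^ d) := rfl

lemma psi0_ne_zero (d : ℕ) : psi0 N d ≠ 0 := fun h =>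
  pow_ne_zero d hsPoly_ne_zero
    (eq_zero_of_bosonLin_eq_zero (fun α => eulerDer_hsPoly_pow α d) h)

/-- The raising operator of the total spin, as a derivation. -/
noncomputable def raisingDer (N : ℕ) : Derivation ℂ (BosonRing N) (BosonRing N) :=
  ∑ β, bosonA β • derB β

/-- The lowering operator of the total spin, as a derivation. -/
noncomputable def loweringDer (N : ℕ) : Derivation ℂ (BosonRing N) (BosonRing N) :=
  ∑ β, bosonB β • derA β

/-- Twice the `z` component of the total spin, as a derivation. -/
noncomputable def heightDer (N : ℕ) : Derivation ℂ (BosonRing N) (BosonRing N) :=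
  ∑ β, (bosonA β • derA β - bosonB β • derB β)

lemma derivation_sum_apply {ι : Type*} (s : Finset ι)
    (D : ι → Derivation ℂ (BosonRing N) (BosonRing N)) (P : BosonRing N) :
    (∑ i ∈ s, D i) P = ∑ i ∈ s, D i P := by
  rw [← Derivation.coeFnAddMonoidHom_apply, map_sum, Finset.sum_apply]
  rfl

lemma raisingDer_apply (P : BosonRing N) : raisingDer N P = ∑ β, bosonA β * derB β P :=
  derivation_sum_apply _ _ _

lemma loweringDer_apply (P : BosonRing N) : loweringDer N P = ∑ β, bosonB β * derA β P :=
  derivation_sum_apply _ _ _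

lemma heightDer_apply (P : BosonRing N) :
    heightDer N P = ∑ β, (bosonA β * derA β P - bosonB β * derB β P) :=
  derivation_sum_apply _ _ _

lemma spinTot_mulVec_bosonLin (d : ℕ) (i : Fin 3) (P : BosonRing N) :
    spinTot N d i *ᵥ bosonLin N d P = bosonLin N d (∑ α, spinDer α i P) := by
  rw [spinTot, Matrix.sum_mulVec, map_sum]
  simp_rw [spin_mulVec_bosonLin]

lemma sum_spinDer_zero (P : BosonRing N) :
    ∑ α, spinDer α 0 P = (1 / 2 : ℂ) • (raisingDer N P + loweringDer N P) := by
  rw [raisingDer_apply, loweringDer_apply, ← Finset.sum_add_distrib, Finset.smul_sum]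
  rfl

lemma sum_spinDer_one (P : BosonRing N) :
    ∑ α, spinDer α 1 P = (-(Complex.I / 2) : ℂ) • (raisingDer N P - loweringDer N P) := by
  rw [raisingDer_apply, loweringDer_apply, ← Finset.sum_sub_distrib, Finset.smul_sum]
  rfl

lemma sum_spinDer_two (P : BosonRing N) :
    ∑ α, spinDer α 2 P = (1 / 2 : ℂ) • heightDer N P := by
  rw [heightDer_apply, Finset.smul_sum]
  rfl

lemma spinTot_comm01 (d : ℕ) :
    spinTot N d 0 * spinTot N d 1 - spinTot N d 1 * spinTot N d 0
      = Complex.I • spinTot N d 2 := by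
  simp only [spinTot, Finset.sum_mul, Finset.mul_sum]
  rw [Finset.sum_comm, ← Finset.sum_sub_distrib, Finset.smul_sum]
  refine Finset.sum_congr rfl fun α _ => ?_
  rw [← Finset.sum_sub_distrib, Finset.sum_eq_single α, spin_comm01]
  · intro β _ hβ
    rw [(spin_comm d hβ.symm 0 1).eq, sub_self]
  · simp

lemma spinTot_conjTranspose (d : ℕ) (i : Fin 3) : (spinTot N d i)ᴴ = spinTot N d i := by
  simp only [spinTot, Matrix.conjTranspose_sum, spin_conjTranspose]

/-- A lowest-weight vector of weight zero is also annihilated by the raising operator. -/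
lemma bosonLin_raisingDer_eq_zero (d : ℕ) {P : BosonRing N} (h1 : loweringDer N P = 0)
    (h2 : heightDer N P = 0) : bosonLin N d (raisingDer N P) = 0 := by
  set X := spinTot N d 0
  set Y := spinTot N d 1
  set ψ := bosonLin N d P
  have hX : X *ᵥ ψ = (1 / 2 : ℂ) • bosonLin N d (raisingDer N P) := by
    rw [spinTot_mulVec_bosonLin, sum_spinDer_zero, h1, add_zero, map_smul]
  have hY : Y *ᵥ ψ = (-(Complex.I / 2) : ℂ) • bosonLin N d (raisingDer N P) := by
    rw [spinTot_mulVec_bosonLin, sum_spinDer_one, h1, sub_zero, map_smul]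
  have hZ : spinTot N d 2 *ᵥ ψ = 0 := by
    rw [spinTot_mulVec_bosonLin, sum_spinDer_two, h2, smul_zero, map_zero]
  have hA : (X + Complex.I • Y) *ᵥ ψ = bosonLin N d (raisingDer N P) := by
    rw [Matrix.add_mulVec, Matrix.smul_mulVec, hX, hY, smul_smul, ← add_smul]
    have : (1 / 2 : ℂ) + Complex.I * -(Complex.I / 2) = 1 := by
      linear_combination (-1 / 2 : ℂ) * Complex.I_mul_I
    rw [this, one_smul]
  have hA' : (X - Complex.I • Y) *ᵥ ψ = 0 := by
    rw [Matrix.sub_mulVec, Matrix.smul_mulVec, hX, hY, smul_smul, ← sub_smul]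
    have : (1 / 2 : ℂ) - Complex.I * -(Complex.I / 2) = 0 := by
      linear_combination (1 / 2 : ℂ) * Complex.I_mul_I
    rw [this, zero_smul]
  have hstar : (X + Complex.I • Y)ᴴ = X - Complex.I • Y := by
    rw [Matrix.conjTranspose_add, Matrix.conjTranspose_smul, spinTot_conjTranspose,
      spinTot_conjTranspose, RCLike.star_def, Complex.conj_I, neg_smul, ← sub_eq_add_neg]
  -- The relation `S⁻S⁺ = S⁺S⁻ - 2Sᶻ`: both terms on the right kill `ψ`, and `S⁻S⁺` is `(S⁺)†S⁺`, so
  -- `S⁺ψ = 0`.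
  have hprod : (X - Complex.I • Y) * (X + Complex.I • Y)
      = (X + Complex.I • Y) * (X - Complex.I • Y) - (2 : ℂ) • spinTot N d 2 := by
    have h3 := congrArg (fun A => (2 * Complex.I) • A) (spinTot_comm01 (N := N) d)
    simp only [smul_smul, smul_sub] at h3
    have h4 : 2 * Complex.I * Complex.I = (-2 : ℂ) := by
      linear_combination (2 : ℂ) * Complex.I_mul_I
    rw [h4] at h3
    simp only [sub_mul, mul_add, add_mul, mul_sub, smul_mul_assoc, mul_smul_comm]
    linear_combination (norm := module) h3
  rw [← hA, ← Matrix.conjTranspose_mul_self_mulVec_eq_zero, hstar, hprod, Matrix.sub_mulVec,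
    Matrix.smul_mulVec, hZ, smul_zero, sub_zero, ← Matrix.mulVec_mulVec, hA', Matrix.mulVec_zero]

lemma two_le_of_even (hN : Even N) (h0 : 0 < N) : 2 ≤ N := by
  obtain ⟨m, rfl⟩ := hN
  omega

lemma loweringDer_hsPoly (hN : 2 ≤ N) : loweringDer N (hsPoly N) = 0 := by
  rw [loweringDer_apply, lowering_hsPoly hN]

lemma heightDer_hsPoly (hN : Even N) : heightDer N (hsPoly N) = 0 := by
  rw [heightDer_apply, sum_spinZ_hsPoly hN]

/-- The commutator of two derivations is a derivation, hence is determined by its values on the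
variables. -/
lemma commute_of_generators (D D' : Derivation ℂ (BosonRing N) (BosonRing N))
    (hA : ∀ γ, D (D' (bosonA γ)) = D' (D (bosonA γ)))
    (hB : ∀ γ, D (D' (bosonB γ)) = D' (D (bosonB γ))) (P : BosonRing N) :
    D (D' P) = D' (D P) := by
  have h : ⁅D, D'⁆ = 0 := by
    refine MvPolynomial.derivation_ext fun i => ?_
    rw [Derivation.commutator_apply, Derivation.zero_apply, sub_eq_zero]
    rcases i with γ | γ
    · exact hA γ
    · exact hB γ
  rw [← sub_eq_zero, ← Derivation.commutator_apply, h, Derivation.zero_apply]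

lemma eulerDer_bosonA (α γ : Fin N) :
    eulerDer α (bosonA γ) = if γ = α then bosonA γ else 0 := by
  rw [eulerDer_apply, derA_bosonA, derB_bosonA]
  split_ifs with h <;> simp [h]

lemma eulerDer_bosonB (α γ : Fin N) :
    eulerDer α (bosonB γ) = if γ = α then bosonB γ else 0 := by
  rw [eulerDer_apply, derA_bosonB, derB_bosonB]
  split_ifs with h <;> simp [h]

lemma raisingDer_bosonA (γ : Fin N) : raisingDer N (bosonA γ) = 0 := by
  simp [raisingDer_apply, derB_bosonA]

lemma raisingDer_bosonB (γ : Fin N) : raisingDer N (bosonB γ) = bosonA γ := by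
  simp [raisingDer_apply, derB_bosonB]

lemma eulerDer_raisingDer (α : Fin N) (P : BosonRing N) :
    eulerDer α (raisingDer N P) = raisingDer N (eulerDer α P) := by
  refine commute_of_generators _ _ (fun γ => ?_) (fun γ => ?_) P
  · rw [raisingDer_bosonA, eulerDer_bosonA, map_zero, apply_ite (raisingDer N),
      raisingDer_bosonA, map_zero, ite_self]
  · rw [raisingDer_bosonB, eulerDer_bosonB, eulerDer_bosonA, apply_ite (raisingDer N),
      raisingDer_bosonB, map_zero]

lemma raisingDer_hsPoly (hN : Even N) (h0 : 0 < N) : raisingDer N (hsPoly N) = 0 := by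
  -- The norm argument is run in the spin-`1/2` chain, where `Ψ^HS` itself is a state; the result is
  -- a polynomial identity, usable for every spin.
  refine eq_zero_of_bosonLin_eq_zero (d := 1) (fun α => ?_)
    (bosonLin_raisingDer_eq_zero 1 (loweringDer_hsPoly (two_le_of_even hN h0))
      (heightDer_hsPoly hN))
  rw [eulerDer_raisingDer, eulerDer_hsPoly, Nat.cast_one, one_smul]

/-- A highest-weight polynomial that is divisible by a variable `b†_α` vanishes. -/
lemma eq_zero_of_raisingDer_eq_zero (α : Fin N) {P : BosonRing N} (h : raisingDer N P = 0)
    (hb : bosonB α ∣ P) : P = 0 := by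
  have hprime : Prime (bosonB α) := MvPolynomial.X_prime
  have hAB : ¬ bosonB α ∣ bosonA α := by
    rw [bosonA, bosonB, MvPolynomial.X_dvd_X]
    simp
  have hpow : ∀ k : ℕ, bosonB α ^ (k + 1) ∣ P := by
    -- For `P = b_α^(k+1) G`, the raising operator gives `b_α^k (b_α · raisingDer G + (k+1) a_α G) =
    -- 0`. Hence the prime `b_α` divides `G`, and the divisibility never stops.
    intro k
    induction k with
    | zero => simpa using hb
    | succ k ih =>
      obtain ⟨G, rfl⟩ := ih
      rw [Derivation.leibniz, derivation_pow, raisingDer_bosonB, Nat.add_sub_cancel,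
        smul_eq_mul, smul_eq_mul] at h
      have h1 : bosonB α ^ k * (bosonB α * raisingDer N G
          + ((k + 1 : ℕ) : BosonRing N) * (bosonA α * G)) = 0 := by
        rw [← h]
        ring
      have h2 := (mul_eq_zero.mp h1).resolve_left (pow_ne_zero k hprime.ne_zero)
      have h3 : bosonB α ∣ ((k + 1 : ℕ) : BosonRing N) * (bosonA α * G) :=
        ⟨-raisingDer N G, by linear_combination h2⟩
      have hunit : IsUnit ((k + 1 : ℕ) : BosonRing N) := by
        have : ((k + 1 : ℕ) : BosonRing N) = MvPolynomial.C ((k + 1 : ℕ) : ℂ) := by simp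
        rw [this]
        exact (IsUnit.mk0 _ (Nat.cast_ne_zero.mpr k.succ_ne_zero)).map MvPolynomial.C
      have h4 : bosonB α ∣ G := by
        rcases hprime.dvd_or_dvd h3 with h5 | h5
        · exact absurd (isUnit_of_dvd_unit h5 hunit) hprime.not_isUnit
        · exact (hprime.dvd_or_dvd h5).resolve_left hAB
      rw [pow_succ]
      exact mul_dvd_mul_left _ h4
  by_contra hP
  obtain ⟨n, hn⟩ := FiniteMultiplicity.of_not_isUnit hprime.not_isUnit hP
  exact hn (hpow n)

/-- The invariant exchange of the spinors of the sites `α` and `β`. -/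
noncomputable def exchangeDer (α β : Fin N) : Derivation ℂ (BosonRing N) (BosonRing N) :=
  (bosonB α * bosonA β - bosonA α * bosonB β) • (bosonA α • derA β + bosonB α • derB β)

lemma exchangeDer_apply (α β : Fin N) (P : BosonRing N) :
    exchangeDer α β P = (bosonB α * bosonA β - bosonA α * bosonB β)
      * (bosonA α * derA β P + bosonB α * derB β P) := rfl

/-- Both factors of the exchange are rotation invariant: `b_α a_β - a_α b_β` is the singlet of two
spinors, and the derivation replaces the spinor of `β` by that of `α`. -/
lemma raisingDer_exchangeDer (α β : Fin N) (P : BosonRing N) :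
    raisingDer N (exchangeDer α β P) = exchangeDer α β (raisingDer N P) := by
  refine commute_of_generators _ _ (fun γ => ?_) (fun γ => ?_) P
  · rw [raisingDer_bosonA, map_zero, exchangeDer_apply, derA_bosonA, derB_bosonA]
    split_ifs
    · simp only [Derivation.leibniz, map_sub, raisingDer_bosonA, raisingDer_bosonB,
        smul_eq_mul, mul_zero, mul_one, add_zero, zero_add]
      ring
    · simp
  · rw [raisingDer_bosonB, exchangeDer_apply, exchangeDer_apply, derA_bosonA, derB_bosonA,
      derA_bosonB, derB_bosonB]
    split_ifs
    · simp only [Derivation.leibniz, map_sub, raisingDer_bosonA, raisingDer_bosonB,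
        smul_eq_mul, mul_zero, mul_one, add_zero, zero_add]
      ring
    · simp

/-- The weighted sum of exchanges that controls `𝐃_α`. -/
noncomputable def cotExchange (α : Fin N) : Derivation ℂ (BosonRing N) (BosonRing N) :=
  ∑ β, cotCoef α β • exchangeDer α β

lemma cotExchange_apply (α : Fin N) (P : BosonRing N) :
    cotExchange α P = ∑ β, cotCoef α β • exchangeDer α β P :=
  derivation_sum_apply _ _ _

lemma cotExchange_hsPoly (hN : Even N) (h0 : 0 < N) (α : Fin N) :
    cotExchange α (hsPoly N) = 0 := by
  refine eq_zero_of_raisingDer_eq_zero α ?_ ?_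
  · rw [cotExchange_apply, map_sum]
    refine Finset.sum_eq_zero fun β _ => ?_
    rw [Derivation.map_smul, raisingDer_exchangeDer, raisingDer_hsPoly hN h0, map_zero, smul_zero]
  · have h1 : ∀ β, exchangeDer α β (hsPoly N)
        = bosonB α * (bosonA β * bosonA α * derA β (hsPoly N)
            + bosonA β * bosonB α * derB β (hsPoly N) - bosonA α * bosonB β * derB β (hsPoly N))
          - bosonA α ^ 2 * (bosonB β * derA β (hsPoly N)) := by
      intro β
      rw [exchangeDer_apply]
      ring
    have h2 : cotExchange α (hsPoly N)
        = bosonB α * ∑ β, cotCoef α β • (bosonA β * bosonA α * derA β (hsPoly N)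
            + bosonA β * bosonB α * derB β (hsPoly N) - bosonA α * bosonB β * derB β (hsPoly N))
          - bosonA α ^ 2 * ∑ β, cotCoef α β • (bosonB β * derA β (hsPoly N)) := by
      rw [cotExchange_apply, Finset.mul_sum, Finset.mul_sum, ← Finset.sum_sub_distrib]
      refine Finset.sum_congr rfl fun β _ => ?_
      rw [h1, smul_sub, mul_smul_comm, mul_smul_comm]
    rw [h2]
    exact dvd_sub (dvd_mul_right _ _)
      ((bosonB_dvd_sum_cotCoef_lowering_hsPoly (two_le_of_even hN h0) α).mul_left _)

/-- By the Leibniz rule the spin-`1/2` identity passes to every spin; this is the reason for writing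
the condition as a first-order derivation. -/
lemma cotExchange_hsPoly_pow (hN : Even N) (h0 : 0 < N) (α : Fin N) (d : ℕ) :
    cotExchange α (hsPoly N ^ d) = 0 := by
  rw [derivation_pow, cotExchange_hsPoly hN h0, mul_zero]

lemma spinTot_mulVec_psi0 (hN : Even N) (h0 : 0 < N) (d : ℕ) (i : Fin 3) :
    spinTot N d i *ᵥ psi0 N d = 0 := by
  have h1 : raisingDer N (hsPoly N ^ d) = 0 := by
    rw [derivation_pow, raisingDer_hsPoly hN h0, mul_zero]
  have h2 : loweringDer N (hsPoly N ^ d) = 0 := by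
    rw [derivation_pow, loweringDer_hsPoly (two_le_of_even hN h0), mul_zero]
  have h3 : heightDer N (hsPoly N ^ d) = 0 := by
    rw [derivation_pow, heightDer_hsPoly hN, mul_zero]
  have h4 : ∑ α, spinDer α i (hsPoly N ^ d) = 0 := by
    fin_cases i
    · exact (sum_spinDer_zero _).trans (by rw [h1, h2, add_zero, smul_zero])
    · exact (sum_spinDer_one _).trans (by rw [h1, h2, sub_zero, smul_zero])
    · exact (sum_spinDer_two _).trans (by rw [h3, smul_zero])
  rw [psi0_eq, spinTot_mulVec_bosonLin, h4, map_zero]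

end Singlet

/-! ### The spin `S + 1` component and annihilation by `𝐃_α` -/

section TopProjection

variable {N : ℕ}

lemma spinDer_zero_apply (α : Fin N) (P : BosonRing N) :
    spinDer α 0 P = (1 / 2 : ℂ) • (bosonA α * derB α P + bosonB α * derA α P) := rfl

lemma spinDer_one_apply (α : Fin N) (P : BosonRing N) :
    spinDer α 1 P = (-(Complex.I / 2) : ℂ) • (bosonA α * derB α P - bosonB α * derA α P) := rfl

lemma spinDer_two_apply (α : Fin N) (P : BosonRing N) :
    spinDer α 2 P = (1 / 2 : ℂ) • (bosonA α * derA α P - bosonB α * derB α P) := rfl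

lemma crossMatrix_mulVec {R : Type*} [Ring R] [Algebra ℂ R] (S V : Fin 3 → R) :
    crossMatrix S *ᵥ V = Complex.I •
      ![S 1 * V 2 - S 2 * V 1, S 2 * V 0 - S 0 * V 2, S 0 * V 1 - S 1 * V 0] := by
  funext i
  fin_cases i <;>
    simp [Matrix.mulVec, dotProduct, Fin.sum_univ_three, crossMatrix] <;> module

/-- The action of `siteMatrix` on vectors of polynomials. -/
noncomputable def topVec (d : ℕ) (α : Fin N) (Φ : Fin 3 → BosonRing N) : Fin 3 → BosonRing N :=
  fun i => Complex.I • (![spinDer α 1 (Φ 2) - spinDer α 2 (Φ 1),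
      spinDer α 2 (Φ 0) - spinDer α 0 (Φ 2), spinDer α 0 (Φ 1) - spinDer α 1 (Φ 0)] i)
    + ((spinS d : ℂ) + 1) • Φ i
    - (1 / ((spinS d : ℂ) + 1)) • spinDer α i (∑ j, spinDer α j (Φ j))

lemma siteMatrix_mulVec_mulVec_bosonLin (d : ℕ) (α : Fin N) (V : Fin 3 → Op N d)
    (P : BosonRing N) (Φ : Fin 3 → BosonRing N)
    (h : ∀ j, V j *ᵥ bosonLin N d P = bosonLin N d (Φ j)) (i : Fin 3) :
    (siteMatrix d α *ᵥ V) i *ᵥ bosonLin N d P = bosonLin N d (topVec d α Φ i) := by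
  have h2 : ∀ k j, (spin d α k * V j) *ᵥ bosonLin N d P = bosonLin N d (spinDer α k (Φ j)) := by
    intro k j
    rw [← Matrix.mulVec_mulVec, h, spin_mulVec_bosonLin]
  have h3 : (crossMatrix (spin d α) *ᵥ V) i *ᵥ bosonLin N d P
      = bosonLin N d (Complex.I • (![spinDer α 1 (Φ 2) - spinDer α 2 (Φ 1),
      spinDer α 2 (Φ 0) - spinDer α 0 (Φ 2), spinDer α 0 (Φ 1) - spinDer α 1 (Φ 0)] i)) := by
    rw [crossMatrix_mulVec, Pi.smul_apply, Matrix.smul_mulVec, map_smul]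
    congr 1
    fin_cases i <;> simp [Matrix.sub_mulVec, h2]
  rw [siteMatrix, topMatrix, Matrix.sub_mulVec, Matrix.add_mulVec, Matrix.smul_mulVec,
    Matrix.smul_mulVec, Matrix.one_mulVec]
  simp only [Pi.sub_apply, Pi.add_apply, Pi.smul_apply, vecMulVec_mulVec_eq]
  rw [Matrix.sub_mulVec, Matrix.add_mulVec, Matrix.smul_mulVec, Matrix.smul_mulVec, h3, h,
    ← Matrix.mulVec_mulVec, dotProduct, Matrix.sum_mulVec]
  simp_rw [h2]
  rw [← map_sum, spin_mulVec_bosonLin, topVec, map_sub, map_add, map_smul _ _ (Φ i),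
    map_smul _ (1 / ((spinS d : ℂ) + 1))]

lemma derA_derB_comm (α β : Fin N) (P : BosonRing N) :
    derA α (derB β P) = derB β (derA α P) := by
  refine commute_of_generators _ _ (fun γ => ?_) (fun γ => ?_) P
  · rw [derB_bosonA, derA_bosonA, map_zero]
    split_ifs <;> simp
  · rw [derA_bosonB, derB_bosonB, map_zero]
    split_ifs <;> simp

/-- If the spin `s + 1` part of a vector of polynomials of degree `2s` vanishes, so does its image
under `topVec`.  Here the vector is given by its components `Φ^±` and `Φ^z`. -/
lemma top_components_eq_zero (d : ℕ) (α : Fin N) (P M Z : BosonRing N)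
    (hP : eulerDer α P = (d : ℂ) • P) (hM : eulerDer α M = (d : ℂ) • M)
    (hZ : eulerDer α Z = (d : ℂ) • Z)
    (hW : bosonB α ^ 2 * P - bosonA α ^ 2 * M + 2 * (bosonA α * bosonB α * Z) = 0) :
    let a := bosonA α
    let b := bosonB α
    let Y := a * derB α M + b * derA α P + (a * derA α Z - b * derB α Z)
    ((d : BosonRing N) + 2) * (2 * (a * derB α Z) - (a * derA α P - b * derB α P))
        + (d + 2) ^ 2 * P - 2 * (a * derB α Y) = 0 ∧
    ((d : BosonRing N) + 2) * (-2 * (b * derA α Z) + (a * derA α M - b * derB α M))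
        + (d + 2) ^ 2 * M - 2 * (b * derA α Y) = 0 ∧
    ((d : BosonRing N) + 2) * (b * derA α P - a * derB α M) + (d + 2) ^ 2 * Z
        - (a * derA α Y - b * derB α Y) = 0 := by
  intro a b Y
  have haa : derA α a = 1 := by rw [derA_bosonA, if_pos rfl]
  have hbb : derB α b = 1 := by rw [derB_bosonB, if_pos rfl]
  have hab : derA α b = 0 := derA_bosonB α α
  have hba : derB α a = 0 := derB_bosonA α α
  have e : ∀ Q, eulerDer α Q = (d : ℂ) • Q →
      a * derA α Q + b * derB α Q = d * Q := by
    intro Q hQ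
    rw [← eulerDer_apply, hQ, Nat.cast_smul_eq_nsmul, nsmul_eq_mul]
  have nA : ∀ n : ℕ, derA α (n : BosonRing N) = 0 := fun n => Derivation.map_natCast _ n
  have nB : ∀ n : ℕ, derB α (n : BosonRing N) = 0 := fun n => Derivation.map_natCast _ n
  have two : (2 : BosonRing N) = ((2 : ℕ) : BosonRing N) := rfl
  have eA : ∀ Q, eulerDer α Q = (d : ℂ) • Q →
      derA α Q + a * derA α (derA α Q) + b * derB α (derA α Q) = d * derA α Q := by
    intro Q hQ
    have := congrArg (derA α) (e Q hQ)
    simp only [map_add, Derivation.leibniz, smul_eq_mul, haa, hab, nA, derA_derB_comm] at this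
    linear_combination this
  have eB : ∀ Q, eulerDer α Q = (d : ℂ) • Q →
      derB α Q + a * derB α (derA α Q) + b * derB α (derB α Q) = d * derB α Q := by
    intro Q hQ
    have := congrArg (derB α) (e Q hQ)
    simp only [map_add, Derivation.leibniz, smul_eq_mul, hba, hbb, nB] at this
    linear_combination this
  have ePA := eA P hP
  have ePB := eB P hP
  have eMA := eA M hM
  have eMB := eB M hM
  have eZA := eA Z hZ
  have eZB := eB Z hZ
  have eP := e P hP
  have eM := e M hM
  have eZ := e Z hZ
  -- The three claims are `2 ∂_b²`, `-2 ∂_a²` and `2 ∂_a ∂_b` of the polynomial in `hW`, modulo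
  -- Euler relations for `P`, `M`, `Z` and their first derivatives.
  have wB := congrArg (derB α) hW
  have wA := congrArg (derA α) hW
  have wBB := congrArg (derB α) wB
  have wAA := congrArg (derA α) wA
  have wAB := congrArg (derA α) wB
  change derB α (derB α (b ^ 2 * P - a ^ 2 * M + 2 * (a * b * Z))) = _ at wBB
  change derA α (derA α (b ^ 2 * P - a ^ 2 * M + 2 * (a * b * Z))) = _ at wAA
  change derA α (derB α (b ^ 2 * P - a ^ 2 * M + 2 * (a * b * Z))) = _ at wAB
  simp only [map_add, map_sub, Derivation.leibniz, pow_two, two, smul_eq_mul, haa, hab, hba, hbb,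
    nA, nB, derA_derB_comm, map_zero, mul_zero, add_zero, zero_add, mul_one] at wBB wAA wAB
  push_cast at wBB wAA wAB
  refine ⟨?_, ?_, ?_⟩
  · simp only [Y, map_add, map_sub, Derivation.leibniz, smul_eq_mul, hba, hbb, mul_zero, add_zero,
      mul_one]
    linear_combination 2 * wBB - 2 * a * eZB - 2 * b * ePB - (d + 4) * eP
  · simp only [Y, map_add, map_sub, Derivation.leibniz, smul_eq_mul, haa, hab, derA_derB_comm,
      mul_zero, add_zero, mul_one]
    linear_combination -2 * wAA + 2 * b * eZA - 2 * a * eMA - (d + 4) * eM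
  · simp only [Y, map_add, map_sub, Derivation.leibniz, smul_eq_mul, haa, hab, hba, hbb,
      derA_derB_comm, mul_zero, add_zero, mul_one]
    linear_combination 2 * wAB - b * ePA + a * eMB - a * eZA - b * eZB - (d + 4) * eZ

/-- The hypothesis says that the contraction of `Φ` with the symmetric square of the spinor `(a_α,
b_α)` vanishes. This contraction has `2S + 2` bosons at `α` and carries exactly the spin `S + 1`
part. -/
lemma topVec_eq_zero (d : ℕ) (α : Fin N) (Φ : Fin 3 → BosonRing N)
    (hE : ∀ j, eulerDer α (Φ j) = (d : ℂ) • Φ j)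
    (hW : bosonB α ^ 2 * (Φ 0 + Complex.I • Φ 1) - bosonA α ^ 2 * (Φ 0 - Complex.I • Φ 1)
      + 2 * (bosonA α * bosonB α * Φ 2) = 0) :
    topVec d α Φ = 0 := by
  obtain ⟨h1, h2, h3⟩ := top_components_eq_zero d α (Φ 0 + Complex.I • Φ 1)
    (Φ 0 - Complex.I • Φ 1) (Φ 2)
    (by rw [map_add, Derivation.map_smul, hE, hE, smul_comm, smul_add])
    (by rw [map_sub, Derivation.map_smul, hE, hE, smul_comm, smul_sub]) (hE 2) hW
  have hs := spinS_add_one_ne_zero d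
  have hd : (spinS d : ℂ) = (d : ℂ) / 2 := by simp [spinS]
  have hI : Complex.I * Complex.I = -1 := Complex.I_mul_I
  set Y : BosonRing N := ∑ j, spinDer α j (Φ j) with hY
  have hY2 : bosonA α * derB α (Φ 0 - Complex.I • Φ 1) + bosonB α * derA α (Φ 0 + Complex.I • Φ 1)
      + (bosonA α * derA α (Φ 2) - bosonB α * derB α (Φ 2)) = (2 : ℂ) • Y := by
    rw [hY, Fin.sum_univ_three, spinDer_zero_apply, spinDer_one_apply, spinDer_two_apply]
    simp only [map_add, map_sub, Derivation.map_smul, mul_add, mul_sub, mul_smul_comm]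
    module
  rw [hY2] at h1 h2 h3
  have key : ∀ Q : BosonRing N, ((d : BosonRing N) + 2) * Q = (2 * ((spinS d : ℂ) + 1)) • Q := by
    intro Q
    rw [hd, show (2 * ((d : ℂ) / 2 + 1)) = (d : ℂ) + 2 by ring, MvPolynomial.smul_eq_C_mul,
      map_add, map_natCast, map_ofNat]
  have key2 : ∀ Q : BosonRing N, ((d : BosonRing N) + 2) ^ 2 * Q
      = (2 * ((spinS d : ℂ) + 1) * (2 * ((spinS d : ℂ) + 1))) • Q := by
    intro Q
    rw [pow_two, mul_assoc, key, key, smul_smul]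
  have two : ∀ Q : BosonRing N, 2 * Q = (2 : ℂ) • Q := fun Q => by
    rw [two_smul, two_mul]
  have ntwo : ∀ Q : BosonRing N, -2 * Q = (-2 : ℂ) • Q := fun Q => by
    rw [neg_smul, two_smul, neg_mul, two_mul]
  -- The identities of `top_components_eq_zero` are cleared of denominators with `d + 2 = 2 (S +
  -- 1)`, which leaves an overall factor `4 (S + 1)`.
  have hp : (4 * ((spinS d : ℂ) + 1)) • (topVec d α Φ 0 + Complex.I • topVec d α Φ 1) = 0 := by
    rw [← h1, key, key2, two, two]
    simp only [topVec, ← hY, spinDer_zero_apply, spinDer_one_apply, spinDer_two_apply,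
      Matrix.cons_val_zero, Matrix.cons_val_one, map_add, Derivation.map_smul, mul_add,
      mul_smul_comm]
    match_scalars <;> field_simp <;> ring_nf <;> simp only [Complex.I_sq] <;> ring
  have hm : (4 * ((spinS d : ℂ) + 1)) • (topVec d α Φ 0 - Complex.I • topVec d α Φ 1) = 0 := by
    rw [← h2, key, key2, two, ntwo]
    simp only [topVec, ← hY, spinDer_zero_apply, spinDer_one_apply, spinDer_two_apply,
      Matrix.cons_val_zero, Matrix.cons_val_one, map_sub, Derivation.map_smul, mul_add,
      mul_sub, mul_smul_comm]
    match_scalars <;> field_simp <;> ring_nf <;> simp only [Complex.I_sq] <;> ring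
  have hz : (4 * ((spinS d : ℂ) + 1)) • topVec d α Φ 2 = 0 := by
    rw [← h3, key, key2]
    simp only [topVec, ← hY, spinDer_zero_apply, spinDer_one_apply, spinDer_two_apply,
      Matrix.cons_val_two, Matrix.tail_cons, Matrix.head_cons, map_add, map_sub,
      Derivation.map_smul, mul_add, mul_sub, mul_smul_comm]
    match_scalars <;> field_simp <;> ring_nf <;> simp only [Complex.I_sq] <;> ring
  have h4 : (4 * ((spinS d : ℂ) + 1)) ≠ 0 := mul_ne_zero (by norm_num) hs
  have hp' := (smul_eq_zero.mp hp).resolve_left h4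
  have hm' := (smul_eq_zero.mp hm).resolve_left h4
  have hz' := (smul_eq_zero.mp hz).resolve_left h4
  have h5 : (2 : ℂ) • topVec d α Φ 0 = 0 := by
    linear_combination (norm := module) hp' + hm'
  have h6 : (2 * Complex.I) • topVec d α Φ 1 = 0 := by
    linear_combination (norm := module) hp' - hm'
  funext i
  fin_cases i
  · exact (smul_eq_zero.mp h5).resolve_left (by norm_num)
  · exact (smul_eq_zero.mp h6).resolve_left (by simp)
  · exact hz'

lemma eulerDer_spinDer {α β : Fin N} (h : β ≠ α) (j : Fin 3) (P : BosonRing N) :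
    eulerDer α (spinDer β j P) = spinDer β j (eulerDer α P) := by
  refine commute_of_generators _ _ (fun γ => ?_) (fun γ => ?_) P
  · fin_cases j <;>
      simp only [Fin.zero_eta, Fin.mk_one, Fin.reduceFinMk, spinDer_zero_apply,
        spinDer_one_apply, spinDer_two_apply, eulerDer_bosonA, derA_bosonA, derB_bosonA] <;>
      by_cases h1 : γ = β
    all_goals
      first
      | (subst h1; simp [h, eulerDer_bosonA, eulerDer_bosonB])
      | (by_cases h2 : γ = α <;> simp [h1, h2, derA_bosonA, derB_bosonA, h.symm])
  · fin_cases j <;>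
      simp only [Fin.zero_eta, Fin.mk_one, Fin.reduceFinMk, spinDer_zero_apply,
        spinDer_one_apply, spinDer_two_apply, eulerDer_bosonB, derA_bosonB, derB_bosonB] <;>
      by_cases h1 : γ = β
    all_goals
      first
      | (subst h1; simp [h, eulerDer_bosonA, eulerDer_bosonB])
      | (by_cases h2 : γ = α <;> simp [h1, h2, derA_bosonB, derB_bosonB, h.symm])

lemma opD_mulVec_psi0 (hN : Even N) (h0 : 0 < N) (d : ℕ) (α : Fin N) (i : Fin 3) :
    opD d α i *ᵥ psi0 N d = 0 := by
  set Q := hsPoly N ^ d with hQ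
  set Φ : Fin 3 → BosonRing N := fun j => ∑ β with β ≠ α, cotCoef α β • spinDer β j Q with hΦ
  have hV : ∀ j, (∑ β with β ≠ α, cotCoef α β • spin d β) j *ᵥ bosonLin N d Q
      = bosonLin N d (Φ j) := by
    intro j
    rw [Finset.sum_apply, Matrix.sum_mulVec, hΦ, map_sum]
    refine Finset.sum_congr rfl fun β _ => ?_
    rw [Pi.smul_apply, Matrix.smul_mulVec, spin_mulVec_bosonLin, map_smul]
  have hE : ∀ j, eulerDer α (Φ j) = (d : ℂ) • Φ j := by
    intro j
    simp only [hΦ]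
    rw [map_sum, Finset.smul_sum]
    refine Finset.sum_congr rfl fun β hβ => ?_
    rw [Derivation.map_smul, eulerDer_spinDer (Finset.mem_filter.mp hβ).2, hQ,
      eulerDer_hsPoly_pow, Derivation.map_smul, smul_comm]
  -- Expanding the exchange gives `b_α² S⁺_β - a_α² S⁻_β + 2 a_α b_α Sᶻ_β`, so the contraction is
  -- `cotExchange`, which kills `Ψ^d`.
  have hW : bosonB α ^ 2 * (Φ 0 + Complex.I • Φ 1) - bosonA α ^ 2 * (Φ 0 - Complex.I • Φ 1)
      + 2 * (bosonA α * bosonB α * Φ 2) = 0 := by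
    rw [← cotExchange_hsPoly_pow hN h0 α d, ← hQ, cotExchange_apply]
    have h1 : ∑ β, cotCoef α β • exchangeDer α β Q
        = ∑ β with β ≠ α, cotCoef α β • exchangeDer α β Q := by
      symm
      refine Finset.sum_filter_of_ne fun β _ h1 h2 => h1 ?_
      rw [h2, cotCoef_self, zero_smul]
    have hI : ∀ X : BosonRing N, Complex.I • (-(Complex.I / 2) : ℂ) • X = (1 / 2 : ℂ) • X := by
      intro X
      rw [smul_smul]
      congr 1
      linear_combination (-1 / 2 : ℂ) * Complex.I_mul_I
    have hP : Φ 0 + Complex.I • Φ 1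
        = ∑ β with β ≠ α, cotCoef α β • (bosonA β * derB β Q) := by
      simp only [hΦ, Finset.smul_sum, ← Finset.sum_add_distrib]
      refine Finset.sum_congr rfl fun β _ => ?_
      rw [spinDer_zero_apply, spinDer_one_apply, smul_comm Complex.I, hI]
      module
    have hM : Φ 0 - Complex.I • Φ 1
        = ∑ β with β ≠ α, cotCoef α β • (bosonB β * derA β Q) := by
      simp only [hΦ, Finset.smul_sum, ← Finset.sum_sub_distrib]
      refine Finset.sum_congr rfl fun β _ => ?_
      rw [spinDer_zero_apply, spinDer_one_apply, smul_comm Complex.I, hI]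
      module
    have hZ : 2 * (bosonA α * bosonB α * Φ 2)
        = bosonA α * bosonB α *
          ∑ β with β ≠ α, cotCoef α β • (bosonA β * derA β Q - bosonB β * derB β Q) := by
      have h2 : ∑ β with β ≠ α, cotCoef α β • (bosonA β * derA β Q - bosonB β * derB β Q)
          = Φ 2 + Φ 2 := by
        simp only [hΦ, ← Finset.sum_add_distrib]
        refine Finset.sum_congr rfl fun β _ => ?_
        rw [spinDer_two_apply]
        module
      rw [h2]
      ring
    rw [h1, hP, hM, hZ, Finset.mul_sum, Finset.mul_sum, Finset.mul_sum,
      ← Finset.sum_sub_distrib, ← Finset.sum_add_distrib]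
    refine Finset.sum_congr rfl fun β _ => ?_
    rw [exchangeDer_apply]
    simp only [MvPolynomial.smul_eq_C_mul]
    ring
  rw [opD_eq_mulVec, Matrix.mulVec_smul, Pi.smul_apply, Matrix.smul_mulVec, psi0_eq, ← hQ,
    siteMatrix_mulVec_mulVec_bosonLin d α _ Q Φ hV, topVec_eq_zero d α Φ hE hW, Pi.zero_apply,
    map_zero, smul_zero]

lemma opB_mulVec_psi0 (hN : Even N) (h0 : 0 < N) (d : ℕ) (α : Fin N) (i : Fin 3) :
    opB d α i *ᵥ psi0 N d = 0 := by
  rw [opB_eq_mulVec_spinTot, Matrix.mulVec_smul, Pi.smul_apply, Matrix.smul_mulVec,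
    Matrix.mulVec, dotProduct, Matrix.sum_mulVec]
  simp_rw [← Matrix.mulVec_mulVec, spinTot_mulVec_psi0 hN h0, Matrix.mulVec_zero]
  rw [Finset.sum_const_zero, smul_zero]

/-! ### Positivity and the ground state -/

lemma normSqOp_mulVec_eq_zero {d : ℕ} {A : Fin 3 → Op N d} {ψ : Ket N d}
    (h : ∀ i, A i *ᵥ ψ = 0) : normSqOp A *ᵥ ψ = 0 := by
  rw [normSqOp, Matrix.sum_mulVec]
  refine Finset.sum_eq_zero fun i _ => ?_
  rw [← Matrix.mulVec_mulVec, h, Matrix.mulVec_zero]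

lemma normSqOp_posSemidef {d : ℕ} (A : Fin 3 → Op N d) : (normSqOp A).PosSemidef :=
  Matrix.posSemidef_sum _ fun i _ => Matrix.posSemidef_conjTranspose_mul_self (A i)

lemma spinTot_sq_eq_normSqOp (d : ℕ) :
    spinTot N d ⬝ᵥ spinTot N d = normSqOp (spinTot N d) := by
  simp only [dotProduct, normSqOp, spinTot_conjTranspose]

lemma hamiltonian_sub_posSemidef (N d : ℕ) :
    (hamiltonian N d - (groundEnergy N d : ℂ) • 1).PosSemidef := by
  have hs : 0 ≤ spinS d := by
    rw [spinS]
    positivity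
  have h1 : (2 * (Real.pi : ℂ) ^ 2 / (N : ℂ) ^ 2)
      = ((2 * Real.pi ^ 2 / (N : ℝ) ^ 2 : ℝ) : ℂ) := by push_cast; rfl
  have h2 : 1 / ((2 * (spinS d : ℂ) + 1) * (2 * (spinS d : ℂ) + 3))
      = ((1 / ((2 * spinS d + 1) * (2 * spinS d + 3)) : ℝ) : ℂ) := by push_cast; rfl
  have h3 : ((spinS d : ℂ) + 1) / (2 * (2 * (spinS d : ℂ) + 3))
      = (((spinS d + 1) / (2 * (2 * spinS d + 3)) : ℝ) : ℂ) := by push_cast; rfl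
  rw [← factorization, h1, h2, h3, spinTot_sq_eq_normSqOp]
  have hc : ∀ x : ℝ, 0 ≤ x → (0 : ℂ) ≤ (x : ℂ) := fun x hx => by exact_mod_cast hx
  refine Matrix.PosSemidef.smul (Matrix.PosSemidef.add (Matrix.PosSemidef.smul
    (Matrix.posSemidef_sum _ fun α _ => (normSqOp_posSemidef _).add (normSqOp_posSemidef _))
      (hc _ (by positivity))) (Matrix.PosSemidef.smul (normSqOp_posSemidef _)
      (hc _ (by positivity)))) (hc _ (by positivity))

/-- For an eigenvector `φ` with eigenvalue `E'`, positivity reads `0 ≤ (E' - E) ‖φ‖²`. -/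
lemma isGroundState_of_posSemidef {d : ℕ} {H : Op N d} {E : ℝ} {ψ : Ket N d}
    (hH : (H - (E : ℂ) • 1).PosSemidef) (h0 : ψ ≠ 0) (hψ : (H - (E : ℂ) • 1) *ᵥ ψ = 0) :
    IsGroundState H E ψ := by
  refine ⟨h0, ?_, fun E' φ hφ h => ?_⟩
  · rw [Matrix.sub_mulVec, Matrix.smul_mulVec, Matrix.one_mulVec, sub_eq_zero] at hψ
    exact hψ
  · have h1 := hH.dotProduct_mulVec_nonneg φ
    rw [Matrix.sub_mulVec, Matrix.smul_mulVec, Matrix.one_mulVec, h, ← sub_smul,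
      dotProduct_smul, smul_eq_mul] at h1
    have h2 : 0 < star φ ⬝ᵥ φ := Matrix.dotProduct_star_self_pos_iff.mpr hφ
    -- The order on `ℂ` is only partial, so the sign of `E' - E` is decided among the reals.
    have h3 : (0 : ℂ) ≤ (E' : ℂ) - E := by
      by_contra h4
      have h5 : ((E' - E : ℝ) : ℂ) < 0 := by
        have h6 : E' - E < 0 := by
          by_contra h7
          apply h4
          have : (0 : ℂ) ≤ ((E' - E : ℝ) : ℂ) := by exact_mod_cast not_lt.mp h7
          simpa using this
        exact_mod_cast h6
      have h8 := mul_neg_of_neg_of_pos h5 h2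
      push_cast at h8
      exact absurd h1 (not_le_of_gt h8)
    have h4 : (0 : ℂ) ≤ ((E' - E : ℝ) : ℂ) := by push_cast; exact h3
    have h5 : 0 ≤ E' - E := by exact_mod_cast h4
    linarith

end TopProjection

end SpinChain

theorem mainTheorem2 (N d : ℕ) (hN : 0 < N) (hd : 0 < d) :
    -- the factorization
    (2 * (Real.pi : ℂ) ^ 2 / (N : ℂ) ^ 2) •
        ((1 / ((2 * (spinS d : ℂ) + 1) * (2 * (spinS d : ℂ) + 3))) •
            (∑ α : Fin N, (normSqOp (opD d α)
              + normSqOp (opB d α)))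
          + (((spinS d : ℂ) + 1) / (2 * (2 * (spinS d : ℂ) + 3))) •
            (spinTot N d ⬝ᵥ spinTot N d))
      = hamiltonian N d - (groundEnergy N d : ℂ) • 1 ∧
    -- the operators on the left are positive semidefinite
    (∀ α : Fin N, (normSqOp (opD d α)).PosSemidef) ∧
    (∀ α : Fin N, (normSqOp (opB d α)).PosSemidef) ∧
    (spinTot N d ⬝ᵥ spinTot N d).PosSemidef ∧
    -- hence so is the right-hand side
    (hamiltonian N d - (groundEnergy N d : ℂ) • 1).PosSemidef ∧
    (Even N →
      -- the operators on the left annihilate the state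
      (∀ (α : Fin N) (i : Fin 3), opD d α i *ᵥ psi0 N d = 0) ∧
      (∀ (α : Fin N) (i : Fin 3), opB d α i *ᵥ psi0 N d = 0) ∧
      (∀ i : Fin 3, spinTot N d i *ᵥ psi0 N d = 0) ∧
      (∀ α : Fin N,
        normSqOp (opD d α) *ᵥ psi0 N d = 0) ∧
      (∀ α : Fin N,
        normSqOp (opB d α) *ᵥ psi0 N d = 0) ∧
      (spinTot N d ⬝ᵥ spinTot N d) *ᵥ psi0 N d = 0 ∧
      -- and the state is a ground state
      IsGroundState (hamiltonian N d) (groundEnergy N d)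
        (psi0 N d)) := by
  have hD := fun (he : Even N) (α : Fin N) (i : Fin 3) => opD_mulVec_psi0 he hN d α i
  have hB := fun (he : Even N) (α : Fin N) (i : Fin 3) => opB_mulVec_psi0 he hN d α i
  have hT := fun (he : Even N) (i : Fin 3) => spinTot_mulVec_psi0 he hN d i
  have hTT : Even N → (spinTot N d ⬝ᵥ spinTot N d) *ᵥ psi0 N d = 0 := fun he => by
    rw [spinTot_sq_eq_normSqOp]
    exact normSqOp_mulVec_eq_zero (hT he)
  refine ⟨factorization d, fun α => normSqOp_posSemidef _, fun α => normSqOp_posSemidef _,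
    spinTot_sq_eq_normSqOp (N := N) d ▸ normSqOp_posSemidef _, hamiltonian_sub_posSemidef N d,
    fun he => ⟨hD he, hB he, hT he, fun α => normSqOp_mulVec_eq_zero (hD he α),
      fun α => normSqOp_mulVec_eq_zero (hB he α), hTT he,
      isGroundState_of_posSemidef (hamiltonian_sub_posSemidef N d) (psi0_ne_zero d) ?_⟩⟩
  -- The eigenvalue equation follows from the factorized form, each summand of which kills the
  -- state.
  rw [← factorization, Matrix.smul_mulVec, Matrix.add_mulVec, Matrix.smul_mulVec,
    Matrix.smul_mulVec, hTT he, Matrix.sum_mulVec]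
  simp_rw [Matrix.add_mulVec, normSqOp_mulVec_eq_zero (hD he _),
    normSqOp_mulVec_eq_zero (hB he _)]
  simp
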